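/- In online local learning with $n$ items, $L$ labels and $T$ rounds, an instance is a fixed sequence of pairs of distinct items $(i_t,j_t)$ and payoff functions $P^t:[L]^2\to[-1,1]$, $t=1,\dots,T$, with rational values. In round $t$ a randomized learner, which knows $n$, $L$, $T$, sees $(i_t,j_t)$, answers with labels $(a_t,b_t)\in[L]^2$, and then sees $P^t$. Its regret on the instance is $$\max_{\ell:[n]\to[L]}\ \sum_{t=1}^T P^t(\ell(i_t),\ell(j_t))\;-\;\mathbb E\Big[\sum_{t=1}^T P^t(a_t,b_t)\Big],$$ the expectation being over the learner's randomness. A learner achieves regret $O(\rho(n,L,T))$ in polynomial time if there is a constant $C$ such that its regret is at most $C\,\rho(n,L,T)$ on every instance with $n$ items, $L\ge 1$ labels and $T$ rounds, and its running time is bounded by a polynomial in $n$, $L$, $T$ and the number of bits of the payoff functions. Let $G(n,1/2)$ be the uniformly random graph on $n$ labelled vertices, and let $G(n,1/2,k)$ be $G(n,1/2)$ with a clique added on an independent uniformly random set of $k$ vertices. For $k=k(n)$, these two ensembles are distinguishable in polynomial time if some randomized polynomial-time algorithm which is given a graph answers, for all sufficiently large $n$, "random" with probability at least $\tfrac45$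 on $G(n,1/2)$ and "planted" with probability at least $\tfrac45$ on $G(n,1/2,k)$. The planted clique conjecture states that for no constant $\varepsilon>0$ are $G(n,1/2)$ and $G(n,1/2,\lfloor n^{1/2-\varepsilon}\rfloor)$ distinguishable in polynomial time. **Corollary.** (1) Let $\varepsilon>0$ be a constant. If some learner achieves regret $O(\sqrt{nL^{1-\varepsilon}T})$ in polynomial time, then $G(n,1/2)$ and $G(n,1/2,\lfloor n^{1/2-\varepsilon/6}\rfloor)$ are distinguishable in polynomial time. (2) In particular, if the planted clique conjecture holds, then for no constant $\delta>0$ does a learner achieve regret $O(\sqrt{nL^{1-\delta}T})$ in polynomial time. -/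

import Mathlib

open MeasureTheory Filter
open scoped ENNReal

/-! ### Machine model: a randomized random-access machine with a step count

The memory consists of arrays of natural numbers, each array being indexed by pairs of naturals.
The arithmetic operations are addition and truncated subtraction, so that a number grows by at most
a constant number of bits per step and unit cost per command is polynomially related to Turing
machine time. -/

namespace RAM

/-- A memory: `σ b i j` is the content of cell `(i, j)` of array `b`. -/
abbrev Mem : Type := ℕ → ℕ → ℕ → ℕ

/-- Write `v` into cell `(i, j)` of array `b`. -/
def Mem.set (σ : Mem) (b i j v : ℕ) : Mem :=
  fun b' i' j' => if b' = b ∧ i' = i ∧ j' = j then v else σ b' i' j'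

/-- Expressions. The array of an access is fixed in the program text; its indices are computed. -/
inductive Expr : Type
  | const (c : ℕ)
  | read (b : ℕ) (i j : Expr)
  | add (e f : Expr)
  | sub (e f : Expr)

/-- The value of an expression; `sub` is truncated subtraction. -/
def Expr.eval (σ : Mem) : Expr → ℕ
  | .const c => c
  | .read b i j => σ b (i.eval σ) (j.eval σ)
  | .add e f => e.eval σ + f.eval σ
  | .sub e f => e.eval σ - f.eval σ

/-- Programs. In tests, a nonzero value counts as true. -/
inductive Cmd : Type
  | skip
  | assign (b : ℕ) (i j e : Expr)
  | flip (b : ℕ) (i j : Expr)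
  | seq (c d : Cmd)
  | ite (e : Expr) (c d : Cmd)
  | loop (e : Expr) (c : Cmd)

/-- A configuration: the stack of commands that remain to be executed, and the memory. The machine
has halted when the stack is empty. -/
abbrev Cfg : Type := List Cmd × Mem

/-- One step of the machine. The command `flip` stores a fresh fair random bit. -/
noncomputable def step : Cfg → PMF Cfg
  | ([], σ) => PMF.pure ([], σ)
  | (.skip :: K, σ) => PMF.pure (K, σ)
  | (.assign b i j e :: K, σ) => PMF.pure (K, σ.set b (i.eval σ) (j.eval σ) (e.eval σ))
  | (.flip b i j :: K, σ) => (PMF.uniformOfFintype Bool).map fun x =>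
      (K, σ.set b (i.eval σ) (j.eval σ) (if x then 1 else 0))
  | (.seq c d :: K, σ) => PMF.pure (c :: d :: K, σ)
  | (.ite e c d :: K, σ) => PMF.pure (if e.eval σ ≠ 0 then c :: K else d :: K, σ)
  | (.loop e c :: K, σ) => PMF.pure (if e.eval σ ≠ 0 then c :: .loop e c :: K else K, σ)

/-- The distribution of the configuration after `t` steps. -/
noncomputable def after : ℕ → Cfg → PMF Cfg
  | 0, x => PMF.pure x
  | t + 1, x => (step x).bind (after t)

/-- Started in memory `σ`, the program `c` halts within `t` steps, whatever the coins. -/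
def HaltsWithin (t : ℕ) (c : Cmd) (σ : Mem) : Prop :=
  ∀ x ∈ (after t ([c], σ)).support, x.1 = []

/-- The distribution of the memory after running `c` from `σ` for `t` steps. If the program halts
within `t` steps, this is the distribution of its final memory. -/
noncomputable def exec (t : ℕ) (c : Cmd) (σ : Mem) : PMF Mem :=
  (after t ([c], σ)).map Prod.snd

end RAM

/-! ### Online local learning -/

namespace OnlineLocal

open RAM

/-- A round: a pair of distinct items among `n` and a payoff function on pairs of labels among `L`,
with (rational) values in `[-1, 1]`. -/
structure Round (n L : ℕ) where
  fst : Fin n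
  snd : Fin n
  ne : fst ≠ snd
  payoff : Fin L → Fin L → ℚ
  bound : ∀ a b, |payoff a b| ≤ 1

/-- The number of bits needed to write down the payoff function of a round. -/
def Round.bits {n L : ℕ} (r : Round n L) : ℕ :=
  ∑ a, ∑ b, (1 + Nat.size (r.payoff a b).num.natAbs + Nat.size (r.payoff a b).den)

/-- The size of the instance with `n` items, `L` labels and the rounds `rs`:
`n + L + T` plus the length of the payoff functions. -/
def size (n L : ℕ) (rs : List (Round n L)) : ℕ :=
  n + L + rs.length + (rs.map Round.bits).sum

/-- The total payoff of the best fixed labeling. -/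
noncomputable def opt {n L : ℕ} (rs : List (Round n L)) : ℝ :=
  ⨆ l : Fin n → Fin L, ((rs.map fun r => r.payoff (l r.fst) (l r.snd)).sum : ℝ)

/-- The payoff of a round for the labels `a`, `b` (an arbitrary value if these are not labels, which
is forbidden to learners below). -/
def Round.reward {n L : ℕ} (r : Round n L) (a b : ℕ) : ℚ :=
  if h : a < L ∧ b < L then r.payoff ⟨a, h.1⟩ ⟨b, h.2⟩ else 0

/-- A learner consists of a program that predicts labels for a pair of items and a program that
digests the payoff function revealed afterwards. Both act on the same persistent memory. -/
structure Learner where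
  predict : Cmd
  update : Cmd

/-- The initial memory: array `0` holds `n`, `L`, `T`; everything else is zero. -/
def startMem (n L T : ℕ) : Mem :=
  Mem.set (Mem.set (Mem.set (fun _ _ _ => 0) 0 0 0 n) 0 0 1 L) 0 0 2 T

/-- The items of the round are written into array `1`. -/
def Round.ask {n L : ℕ} (r : Round n L) (σ : Mem) : Mem :=
  (σ.set 1 0 0 r.fst).set 1 0 1 r.snd

/-- The payoff function of the round is written into the arrays `3`, `4`, `5`: at cell `(a, b)`,
the absolute value of the numerator, the sign (`1` if negative), and the denominator. -/
def Round.reveal {n L : ℕ} (r : Round n L) (σ : Mem) : Mem := fun k a b =>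
  if h : a < L ∧ b < L then
    let q := r.payoff ⟨a, h.1⟩ ⟨b, h.2⟩
    if k = 3 then q.num.natAbs
    else if k = 4 then (if q < 0 then 1 else 0)
    else if k = 5 then q.den
    else σ k a b
  else σ k a b

/-- The learner's labels are read off array `2`, cells `(0, 0)` and `(0, 1)`. -/
def label₁ (σ : Mem) : ℕ := σ 2 0 0

/-- The label of the second item. -/
def label₂ (σ : Mem) : ℕ := σ 2 0 1

/-- Playing the rounds `rs` from memory `σ`, each activation of the learner halts within `t` steps
and each answer is a pair of labels, whatever the coins. -/
def Learner.Runs (A : Learner) (t : ℕ) {n L : ℕ} : List (Round n L) → Mem → Prop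
  | [], _ => True
  | r :: rs, σ =>
    HaltsWithin t A.predict (r.ask σ) ∧
    ∀ τ ∈ (exec t A.predict (r.ask σ)).support,
      label₁ τ < L ∧ label₂ τ < L ∧
      HaltsWithin t A.update (r.reveal τ) ∧
      ∀ υ ∈ (exec t A.update (r.reveal τ)).support, A.Runs t rs υ

/-- The distribution of the total payoff when the rounds `rs` are played from memory `σ`, each
activation of the learner being given `t` steps. In each round the learner answers before the payoff
function is revealed. -/
noncomputable def Learner.play (A : Learner) (t : ℕ) {n L : ℕ} : List (Round n L) → Mem → PMF ℚ
  | [], _ => PMF.pure 0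
  | r :: rs, σ =>
    (exec t A.predict (r.ask σ)).bind fun τ =>
    (exec t A.update (r.reveal τ)).bind fun υ =>
    (A.play t rs υ).map fun x => r.reward (label₁ τ) (label₂ τ) + x

/-- The expected total payoff (the distribution has finite support). -/
noncomputable def Learner.expectedPayoff (A : Learner) (t : ℕ) {n L : ℕ}
    (rs : List (Round n L)) : ℝ :=
  ∑' x : ℚ, (A.play t rs (startMem n L rs.length) x).toReal * (x : ℝ)

/-- Some learner achieves regret `O(ρ n L T)` in polynomial time, where `n` is the number of items,
`L ≥ 1` the number of labels and `T` the number of rounds. (There are `2 T` activations, so each of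
them takes polynomial time if and only if the whole run does.) -/
def RegretInPolyTime (ρ : ℕ → ℕ → ℕ → ℝ) : Prop :=
  ∃ (A : Learner) (p : Polynomial ℕ) (C : ℝ),
    ∀ (n L : ℕ) (rs : List (Round n L)), 1 ≤ L →
      A.Runs (p.eval (size n L rs)) rs (startMem n L rs.length) ∧
      opt rs - A.expectedPayoff (p.eval (size n L rs)) rs ≤ C * ρ n L rs.length

end OnlineLocal

/-! ### Planted clique -/

namespace PlantedClique

open RAM

/-- The random graph `G(n, 1/2)`. -/
noncomputable def randomGraph (n : ℕ) : Measure (SimpleGraph (Fin n)) :=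
  SimpleGraph.binomialRandom (Fin n) ⟨1 / 2, by norm_num, by norm_num⟩

/-- The graph whose edges are all pairs of distinct vertices of `S`. -/
def cliqueOn {n : ℕ} (S : Finset (Fin n)) : SimpleGraph (Fin n) :=
  SimpleGraph.fromRel fun u v => u ∈ S ∧ v ∈ S

/-- The random graph `G(n, 1/2, k)`: a uniformly random set of `k` vertices of `G(n, 1/2)`, chosen
independently of the graph, is turned into a clique (for `k ≤ n`). -/
noncomputable def plantedGraph (n k : ℕ) : Measure (SimpleGraph (Fin n)) :=
  (n.choose k : ℝ≥0∞)⁻¹ • ∑ S ∈ Finset.powersetCard k (Finset.univ : Finset (Fin n)),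
    (randomGraph n).map fun G => G ⊔ cliqueOn S

open scoped Classical in
/-- A graph as an input: array `0` holds `n`, array `1` the adjacency matrix; everything else is
zero. -/
noncomputable def graphMem {n : ℕ} (G : SimpleGraph (Fin n)) : Mem := fun k i j =>
  if k = 0 then (if i = 0 ∧ j = 0 then n else 0)
  else if k = 1 then (if ∃ u v : Fin n, G.Adj u v ∧ u.val = i ∧ v.val = j then 1 else 0)
  else 0

/-- The answer of a distinguisher on `G`: `true` ("planted") if cell `(0, 0)` of array `2` is
nonzero at the end, `false` ("random") otherwise. -/
noncomputable def answer (D : Cmd) (t : ℕ) {n : ℕ} (G : SimpleGraph (Fin n)) : PMF Bool :=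
  (exec t D (graphMem G)).map fun σ => decide (σ 2 0 0 ≠ 0)

/-- Some (randomized) polynomial-time algorithm distinguishes `G(n, 1/2)` from `G(n, 1/2, k n)`:
for all sufficiently large `n`, on either ensemble it gives the right answer with probability at
least `4/5` over the graph and its coins. -/
def DistinguishableInPolyTime (k : ℕ → ℕ) : Prop :=
  ∃ (D : Cmd) (p : Polynomial ℕ),
    (∀ (n : ℕ) (G : SimpleGraph (Fin n)), HaltsWithin (p.eval n) D (graphMem G)) ∧
    ∀ᶠ n : ℕ in atTop,
      4 / 5 ≤ ∫⁻ G, answer D (p.eval n) G false ∂(randomGraph n) ∧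
      4 / 5 ≤ ∫⁻ G, answer D (p.eval n) G true ∂(plantedGraph n (k n))

/-- The clique size `n ^ (1/2 - ε)`, rounded down. -/
noncomputable def cliqueSize (ε : ℝ) (n : ℕ) : ℕ := ⌊(n : ℝ) ^ (1 / 2 - ε)⌋₊

/-- The planted clique conjecture: for no constant `ε > 0` can `G(n, 1/2)` and
`G(n, 1/2, n ^ (1/2 - ε))` be distinguished in polynomial time. -/
def Conjecture : Prop := ∀ ε : ℝ, 0 < ε → ¬ DistinguishableInPolyTime (cliqueSize ε)

end PlantedClique

/-! A graph on `N` vertices is turned into a learning instance. There are `n` items and `L = N / n`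
labels, and vertex `n * a + i` stands for label `a` of item `i`. Each pair of items `i < j` is asked
once, and labels `a`, `b` pay `1` if the corresponding vertices are adjacent and `-1` otherwise. The
distinguisher simulates the learner and answers "planted" if the total payoff is at least `2 * n`.

In the random graph the payoff matrices of different item pairs are independent and uniform
(`graphMean_blocks`), and each answer is given before its matrix is seen. The total payoff is
therefore a martingale with steps of size at most 1, its second moment is at most `T ≤ n² / 2`, and
Chebyshev makes a payoff of `2 * n` unlikely (`roundMean_random_le`).

With a clique planted on `S`, an answer has conditional mean payoff 1 if both of its vertices lie in
`S` (a hit) and 0 otherwise, so payoff minus hits is still a martingale (`roundMean_excess`,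
`roundMean_excess_sq`). A labeling that picks a vertex of `S` for each item that has one earns on
average `M`, the number of item pairs both of whose items meet `S`, while no learner has more than
`M` hits. Regret at most `R` forces the expected number of hits to be at least `M - R`. Markov then
rules out a shortfall beyond `20 * R`, and Chebyshev passes from hits to payoff
(`roundMean_planted_le`).

A random `S` of `k` vertices, `k` small compared to `n`, rarely loses half of them to vertices
sharing an item or belonging to none, so `M` is of order `k²` (`card_few_hits_le`,
`card_sq_le_hitPairs`). Here `R` is of order `sqrt (n³ * L ^ (1 - ε))`, and for `n` about `N ^ γ`
with `γ` slightly above `1/2 - ε/6` the number `M` dominates both `R` and `n` (`exists_parameters`).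

On the machine side, the learner's programs run unchanged on shifted arrays (`yields_shift`), and
`yields_distinguisher` gives the exact law of the verdict with a time bound. For `ε > 1` the regret
hypothesis is contradictory (`not_regretInPolyTime`). -/

theorem PMF.bind_congr_support {α β : Type*} (p : PMF α) {f g : α → PMF β}
    (h : ∀ a ∈ p.support, f a = g a) : p.bind f = p.bind g := by
  ext b
  simp only [PMF.bind_apply]
  refine tsum_congr fun a => ?_
  by_cases ha : p a = 0
  · simp [ha]
  · rw [h a ha]

/-! ### Executions of the machine: output law and running time -/

namespace RAM

theorem after_nil (t : ℕ) (σ : Mem) : after t ([], σ) = PMF.pure ([], σ) := by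
  induction t with
  | zero => rfl
  | succ t ih => simp [after, step, ih]

theorem after_add (s t : ℕ) (x : Cfg) : after (s + t) x = (after s x).bind (after t) := by
  induction s generalizing x with
  | zero => simp [after]
  | succ s ih =>
    rw [Nat.succ_add]
    simp only [after, PMF.bind_bind]
    congr 1
    funext y
    exact ih y

/-- From `x` the machine halts within `t` steps, whatever the coins, and `g` of the final memory
has distribution `ν`. -/
def Yields {α : Type*} (g : Mem → α) (t : ℕ) (x : Cfg) (ν : PMF α) : Prop :=
  (∀ y ∈ (after t x).support, y.1 = []) ∧ (after t x).map (fun y => g y.2) = ν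

/-- A halted configuration is fixed by `step`, so additional steps change nothing. This allows every
running time to be rounded up to a convenient bound. -/
theorem Yields.add {α : Type*} {g : Mem → α} {t : ℕ} {x : Cfg} {ν : PMF α}
    (h : Yields g t x ν) (s : ℕ) : Yields g (t + s) x ν := by
  have e : after (t + s) x = after t x := by
    rw [after_add]
    conv_rhs => rw [← PMF.bind_pure (after t x)]
    refine PMF.bind_congr_support _ fun y hy => ?_
    obtain ⟨K, σ⟩ := y
    obtain rfl : K = [] := h.1 _ hy
    exact after_nil s σ
  simpa only [Yields, e] using h

theorem Yields.mono {α : Type*} {g : Mem → α} {t s : ℕ} {x : Cfg} {ν : PMF α}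
    (h : Yields g t x ν) (hts : t ≤ s) : Yields g s x ν := by
  obtain ⟨u, rfl⟩ := Nat.exists_eq_add_of_le hts
  exact h.add u

theorem Yields.nil {α : Type*} (g : Mem → α) (t : ℕ) (σ : Mem) :
    Yields g t ([], σ) (PMF.pure (g σ)) := by
  simp [Yields, after_nil, PMF.pure_map]

theorem Yields.of_step {α β : Type*} {g : Mem → α} {t : ℕ} {x : Cfg} {ρ : PMF β} {e : β → Cfg}
    {f : β → PMF α} (hx : step x = ρ.map e) (h : ∀ y ∈ ρ.support, Yields g t (e y) (f y)) :
    Yields g (t + 1) x (ρ.bind f) := by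
  have hx' : after (t + 1) x = ρ.bind fun y => after t (e y) := by
    simp only [after, hx, PMF.bind_map]; rfl
  constructor
  · intro y hy
    rw [hx', PMF.mem_support_bind_iff] at hy
    obtain ⟨z, hz, hy⟩ := hy
    exact (h z hz).1 y hy
  · rw [hx', PMF.map_bind]
    exact PMF.bind_congr_support _ fun y hy => (h y hy).2

/-- From `x` the machine reaches `y` within `t` steps, without tossing coins. -/
def Reach (t : ℕ) (x y : Cfg) : Prop := ∃ u ≤ t, after u x = PMF.pure y

theorem Reach.mono {s t : ℕ} {x y : Cfg} (h : Reach s x y) (hst : s ≤ t) : Reach t x y :=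
  ⟨h.choose, h.choose_spec.1.trans hst, h.choose_spec.2⟩

theorem Reach.trans {s t : ℕ} {x y z : Cfg} (h : Reach s x y) (h' : Reach t y z) :
    Reach (s + t) x z := by
  obtain ⟨u, hu, hu'⟩ := h
  obtain ⟨v, hv, hv'⟩ := h'
  exact ⟨u + v, add_le_add hu hv, by rw [after_add, hu', PMF.pure_bind, hv']⟩

theorem Reach.yields {α : Type*} {g : Mem → α} {s t : ℕ} {x y : Cfg} {ν : PMF α}
    (h : Reach s x y) (h' : Yields g t y ν) : Yields g (s + t) x ν := by
  obtain ⟨u, hu, hu'⟩ := h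
  refine Yields.mono (t := u + t) ?_ (by omega)
  simpa only [Yields, after_add, hu', PMF.pure_bind] using h'

theorem Reach.of_step {x y : Cfg} (h : step x = PMF.pure y) : Reach 1 x y :=
  ⟨1, le_rfl, by simp [after, h, PMF.bind_pure]⟩

theorem reach_skip (K : List Cmd) (σ : Mem) : Reach 1 (.skip :: K, σ) (K, σ) := .of_step rfl

theorem reach_assign (b : ℕ) (i j e : Expr) (K : List Cmd) (σ : Mem) :
    Reach 1 (.assign b i j e :: K, σ) (K, σ.set b (i.eval σ) (j.eval σ) (e.eval σ)) := .of_step rfl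

theorem reach_seq (c d : Cmd) (K : List Cmd) (σ : Mem) :
    Reach 1 (.seq c d :: K, σ) (c :: d :: K, σ) := .of_step rfl

theorem reach_ite_true {e : Expr} {σ : Mem} (h : e.eval σ ≠ 0) (c d : Cmd) (K : List Cmd) :
    Reach 1 (.ite e c d :: K, σ) (c :: K, σ) := .of_step (by simp [step, h])

theorem reach_ite_false {e : Expr} {σ : Mem} (h : e.eval σ = 0) (c d : Cmd) (K : List Cmd) :
    Reach 1 (.ite e c d :: K, σ) (d :: K, σ) := .of_step (by simp [step, h])

theorem reach_loop_true {e : Expr} {σ : Mem} (h : e.eval σ ≠ 0) (c : Cmd) (K : List Cmd) :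
    Reach 1 (.loop e c :: K, σ) (c :: .loop e c :: K, σ) := .of_step (by simp [step, h])

theorem reach_loop_false {e : Expr} {σ : Mem} (h : e.eval σ = 0) (c : Cmd) (K : List Cmd) :
    Reach 1 (.loop e c :: K, σ) (K, σ) := .of_step (by simp [step, h])

/-! ### Running a program on a part of the arrays -/

/-- The expression that uses array `b + d` in place of array `b`. -/
def Expr.shift (d : ℕ) : Expr → Expr
  | .const c => .const c
  | .read b i j => .read (b + d) (i.shift d) (j.shift d)
  | .add e f => .add (e.shift d) (f.shift d)
  | .sub e f => .sub (e.shift d) (f.shift d)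

/-- The program that uses array `b + d` in place of array `b`. -/
def Cmd.shift (d : ℕ) : Cmd → Cmd
  | .skip => .skip
  | .assign b i j e => .assign (b + d) (i.shift d) (j.shift d) (e.shift d)
  | .flip b i j => .flip (b + d) (i.shift d) (j.shift d)
  | .seq c e => .seq (c.shift d) (e.shift d)
  | .ite e c f => .ite (e.shift d) (c.shift d) (f.shift d)
  | .loop e c => .loop (e.shift d) (c.shift d)

/-- The memory whose first `d` arrays are those of `φ`, followed by the arrays of `σ`. -/
def Mem.join (d : ℕ) (φ σ : Mem) : Mem := fun b => if b < d then φ b else σ (b - d)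

theorem Mem.join_add (d : ℕ) (φ σ : Mem) (b : ℕ) : Mem.join d φ σ (b + d) = σ b := by
  simp [Mem.join]

theorem Mem.join_set (d : ℕ) (φ σ : Mem) (b i j v : ℕ) :
    (Mem.join d φ σ).set (b + d) i j v = Mem.join d φ (σ.set b i j v) := by
  funext b' i' j'
  by_cases h : b' < d
  · have : b' ≠ b + d := by omega
    simp [Mem.join, Mem.set, h, this]
  · have : b' = b + d ↔ b' - d = b := by omega
    simp [Mem.join, Mem.set, h, this]

theorem Expr.eval_shift (d : ℕ) (φ σ : Mem) (e : Expr) :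
    (e.shift d).eval (Mem.join d φ σ) = e.eval σ := by
  induction e with
  | const c => rfl
  | read b i j hi hj => simp [Expr.shift, Expr.eval, hi, hj, Mem.join_add]
  | add e f he hf => simp [Expr.shift, Expr.eval, he, hf]
  | sub e f he hf => simp [Expr.shift, Expr.eval, he, hf]

/-- Addresses and tests of a shifted command never refer to the first `d` arrays, so the machine on
the joined memory moves in lockstep with the original one, carrying the frame `φ` and the pending
commands `K'` along. -/
theorem step_shift (d : ℕ) (φ σ : Mem) (c : Cmd) (K K' : List Cmd) :
    step ((c :: K).map (Cmd.shift d) ++ K', Mem.join d φ σ) =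
      (step (c :: K, σ)).map fun y => (y.1.map (Cmd.shift d) ++ K', Mem.join d φ y.2) := by
  cases c with
  | flip b i j =>
    simp only [List.map_cons, Cmd.shift, List.cons_append, step, Expr.eval_shift, PMF.map_comp]
    congr 1
    funext x
    simp [Mem.join_set]
  | ite e c f =>
    simp only [List.map_cons, Cmd.shift, List.cons_append, step, Expr.eval_shift, PMF.pure_map]
    split_ifs <;> simp
  | loop e c =>
    simp only [List.map_cons, Cmd.shift, List.cons_append, step, Expr.eval_shift, PMF.pure_map]
    split_ifs <;> simp [Cmd.shift]
  | _ => simp [Cmd.shift, step, Expr.eval_shift, PMF.pure_map, Mem.join_set]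

/-- The lockstep is followed until the embedded commands are used up, which may happen early and at
a time depending on the coins. The continuation then starts from each possible final memory, and
`Yields.mono` absorbs the unused steps. -/
theorem yields_shift_stack {α : Type*} {g : Mem → α} (d : ℕ) (φ : Mem) {t s : ℕ} {K K' : List Cmd}
    {σ : Mem} {f : Mem → PMF α} (hK : ∀ y ∈ (after t (K, σ)).support, y.1 = [])
    (h : ∀ τ ∈ ((after t (K, σ)).map Prod.snd).support, Yields g s (K', Mem.join d φ τ) (f τ)) :
    Yields g (t + s) (K.map (Cmd.shift d) ++ K', Mem.join d φ σ)
      (((after t (K, σ)).map Prod.snd).bind f) := by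
  induction t generalizing K σ with
  | zero =>
    obtain rfl : K = [] := hK (K, σ) (by simp [after])
    simpa [after, PMF.pure_map, PMF.pure_bind] using h
  | succ t ih =>
    cases K with
    | nil =>
      simp only [after_nil, PMF.pure_map, PMF.pure_bind] at h ⊢
      exact (h σ (by simp)).mono (by omega)
    | cons c K =>
      rw [Nat.add_right_comm]
      have := Yields.of_step (t := t + s) (g := g)
        (f := fun y => ((after t y).map Prod.snd).bind f) (step_shift d φ σ c K K')
        (fun y hy => ih (K := y.1) (σ := y.2)
          (fun z hz => hK z ((PMF.mem_support_bind_iff _ _ _).2 ⟨y, hy, hz⟩))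
          (fun τ hτ => h τ (by
            rw [PMF.mem_support_map_iff] at hτ ⊢
            obtain ⟨z, hz, rfl⟩ := hτ
            exact ⟨z, (PMF.mem_support_bind_iff _ _ _).2 ⟨y, hy, hz⟩, rfl⟩)))
      simpa only [after, PMF.map_bind, PMF.bind_bind] using this

theorem yields_shift {α : Type*} {g : Mem → α} (d : ℕ) (φ : Mem) {t s : ℕ} {c : Cmd}
    {K : List Cmd} {σ : Mem} {f : Mem → PMF α} (hc : HaltsWithin t c σ)
    (h : ∀ τ ∈ (exec t c σ).support, Yields g s (K, Mem.join d φ τ) (f τ)) :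
    Yields g (t + s) (c.shift d :: K, Mem.join d φ σ) ((exec t c σ).bind f) :=
  yields_shift_stack (K := [c]) d φ hc h

/-- A step has at most two outcomes. Finite support makes the expectations below finite sums, so
that they can be added and interchanged freely. -/
theorem finite_support_step (x : Cfg) : (step x).support.Finite := by
  obtain ⟨_ | ⟨c, K⟩, σ⟩ := x
  · simp [step]
  · cases c <;> simp [step, Set.toFinite]

theorem finite_support_after (t : ℕ) (x : Cfg) : (after t x).support.Finite := by
  induction t generalizing x with
  | zero => simp [after]
  | succ t ih =>
    rw [after, PMF.support_bind]
    exact (finite_support_step x).biUnion fun y _ => ih y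

theorem finite_support_exec (t : ℕ) (c : Cmd) (σ : Mem) : (exec t c σ).support.Finite := by
  rw [exec, PMF.support_map]
  exact (finite_support_after t _).image _

end RAM

/-! ### Expectations under finitely supported distributions -/

namespace PMF

variable {α β : Type*}

/-- The expectation of a real function. -/
noncomputable def ev (μ : PMF α) (f : α → ℝ) : ℝ := ∑' a, (μ a).toReal * f a

theorem summable_ev {μ : PMF α} (h : μ.support.Finite) (f : α → ℝ) :
    Summable fun a => (μ a).toReal * f a := by
  refine summable_of_hasFiniteSupport (h.subset fun a ha => ?_)
  rw [PMF.mem_support_iff]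
  intro h0
  simp [h0] at ha

theorem ev_eq_sum {μ : PMF α} (h : μ.support.Finite) (f : α → ℝ) :
    μ.ev f = ∑ a ∈ h.toFinset, (μ a).toReal * f a := by
  refine tsum_eq_sum fun a ha => ?_
  have : μ a = 0 := by simpa using ha
  simp [this]

theorem ev_pure (a : α) (f : α → ℝ) : (PMF.pure a).ev f = f a := by
  rw [ev, tsum_eq_single a]
  · simp
  · intro b hb
    simp [PMF.pure_apply_of_ne _ _ hb]

theorem ev_bind {μ : PMF α} {κ : α → PMF β} (h : μ.support.Finite)
    (hκ : ∀ a, (κ a).support.Finite) (f : β → ℝ) :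
    (μ.bind κ).ev f = μ.ev fun a => (κ a).ev f := by
  rw [ev_eq_sum h]
  have h1 : ∀ b, ((μ.bind κ) b).toReal = ∑ a ∈ h.toFinset, (μ a).toReal * (κ a b).toReal := by
    intro b
    rw [PMF.bind_apply, tsum_eq_sum (s := h.toFinset), ENNReal.toReal_sum]
    · simp [ENNReal.toReal_mul]
    · intro a _
      exact ENNReal.mul_ne_top (μ.apply_ne_top a) ((κ a).apply_ne_top b)
    · intro a ha
      have : μ a = 0 := by simpa using ha
      simp [this]
  simp only [ev, h1, Finset.sum_mul, mul_assoc]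
  rw [Summable.tsum_finsetSum]
  · simp only [tsum_mul_left]
  · intro a _
    exact (summable_ev (hκ a) f).mul_left _

theorem ev_map {μ : PMF α} (h : μ.support.Finite) (e : α → β) (f : β → ℝ) :
    (μ.map e).ev f = μ.ev fun a => f (e a) := by
  rw [← PMF.bind_pure_comp, ev_bind h (fun a => by simp)]
  simp [ev_pure]

theorem ev_add {μ : PMF α} (h : μ.support.Finite) (f g : α → ℝ) :
    (μ.ev fun a => f a + g a) = μ.ev f + μ.ev g := by
  simp only [ev, mul_add]
  exact (summable_ev h f).tsum_add (summable_ev h g)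

theorem ev_const_mul (μ : PMF α) (c : ℝ) (f : α → ℝ) : (μ.ev fun a => c * f a) = c * μ.ev f := by
  simp only [ev, mul_left_comm _ c, tsum_mul_left]

theorem ev_const (μ : PMF α) (c : ℝ) : (μ.ev fun _ => c) = c := by
  have : ∑' a, (μ a).toReal = 1 := by
    rw [← ENNReal.tsum_toReal_eq μ.apply_ne_top, μ.tsum_coe, ENNReal.toReal_one]
  rw [ev, tsum_mul_right, this, one_mul]

theorem ev_sub {μ : PMF α} (h : μ.support.Finite) (f g : α → ℝ) :
    (μ.ev fun a => f a - g a) = μ.ev f - μ.ev g := by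
  simp only [ev, mul_sub]
  exact (summable_ev h f).tsum_sub (summable_ev h g)

theorem ev_mono {μ : PMF α} (h : μ.support.Finite) {f g : α → ℝ}
    (hfg : ∀ a ∈ μ.support, f a ≤ g a) : μ.ev f ≤ μ.ev g := by
  rw [ev_eq_sum h, ev_eq_sum h]
  exact Finset.sum_le_sum fun a ha =>
    mul_le_mul_of_nonneg_left (hfg a (by simpa using ha)) ENNReal.toReal_nonneg

theorem ev_sum {ι : Type*} {μ : PMF α} (h : μ.support.Finite) (s : Finset ι) (f : ι → α → ℝ) :
    (μ.ev fun a => ∑ i ∈ s, f i a) = ∑ i ∈ s, μ.ev (f i) := by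
  simp only [ev_eq_sum h, Finset.mul_sum]
  exact Finset.sum_comm

theorem toReal_apply_eq_ev [DecidableEq α] (μ : PMF α) (a : α) :
    (μ a).toReal = μ.ev fun x => if x = a then 1 else 0 := by
  rw [ev, tsum_eq_single a]
  · simp
  · intro b hb
    simp [hb]

end PMF

/-! ### Random sign rounds: payoff minus hits as a martingale -/

namespace OnlineLocal

open RAM

variable {n L : ℕ}

/-- A pair of distinct items. -/
abbrev ItemPair (n : ℕ) : Type := {p : Fin n × Fin n // p.1 ≠ p.2}

/-- The round with payoffs `±1` given by a Boolean matrix. -/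
def signRound (p : ItemPair n) (w : Fin L → Fin L → Bool) : Round n L where
  fst := p.1.1
  snd := p.1.2
  ne := p.2
  payoff a b := if w a b then 1 else -1
  bound a b := by split_ifs <;> simp

/-- The matrix `β` with the entries of a planted product set turned to `true`. -/
def plant (H : Fin n → Fin L → Bool) (p : ItemPair n) (β : Fin L → Fin L → Bool) :
    Fin L → Fin L → Bool := fun a b => β a b || (H p.1.1 a && H p.1.2 b)

/-- The mean over a uniformly random Boolean matrix. -/
noncomputable def matrixMean (f : (Fin L → Fin L → Bool) → ℝ) : ℝ :=
  (Fintype.card (Fin L → Fin L → Bool) : ℝ)⁻¹ * ∑ β, f β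

theorem matrixMean_const (c : ℝ) : matrixMean (fun _ : Fin L → Fin L → Bool => c) = c := by
  have : (Fintype.card (Fin L → Fin L → Bool) : ℝ) ≠ 0 := Nat.cast_ne_zero.2 Fintype.card_ne_zero
  rw [matrixMean, Finset.sum_const, nsmul_eq_mul, Finset.card_univ, ← mul_assoc,
    inv_mul_cancel₀ this, one_mul]

theorem matrixMean_add (f g : (Fin L → Fin L → Bool) → ℝ) :
    (matrixMean fun β => f β + g β) = matrixMean f + matrixMean g := by
  simp only [matrixMean, Finset.sum_add_distrib, mul_add]

theorem matrixMean_const_mul (c : ℝ) (f : (Fin L → Fin L → Bool) → ℝ) :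
    (matrixMean fun β => c * f β) = c * matrixMean f := by
  simp only [matrixMean, ← Finset.mul_sum, mul_left_comm c]

theorem matrixMean_mono {f g : (Fin L → Fin L → Bool) → ℝ} (h : ∀ β, f β ≤ g β) :
    matrixMean f ≤ matrixMean g :=
  mul_le_mul_of_nonneg_left (Finset.sum_le_sum fun β _ => h β) (by positivity)

theorem ev_matrixMean {α : Type*} {μ : PMF α} (h : μ.support.Finite)
    (f : (Fin L → Fin L → Bool) → α → ℝ) :
    (μ.ev fun a => matrixMean fun β => f β a) = matrixMean fun β => μ.ev (f β) := by
  simp only [matrixMean, PMF.ev_const_mul, PMF.ev_sum h]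

/-- Negating all entries of the matrix is a measure-preserving involution that changes the sign of
the payoff. -/
theorem matrixMean_sign (a b : Fin L) :
    (matrixMean fun β : Fin L → Fin L → Bool => if β a b then (1 : ℝ) else -1) = 0 := by
  have h : ∑ β : Fin L → Fin L → Bool, (if β a b then (1 : ℝ) else -1) =
      ∑ β : Fin L → Fin L → Bool, -(if β a b then (1 : ℝ) else -1) := by
    refine Fintype.sum_bijective (fun β a b => !β a b)
      (Function.Involutive.bijective fun β => by simp) _ _ fun β => ?_
    simp only [Bool.not_eq_true']
    cases β a b <;> simp
  rw [Finset.sum_neg_distrib] at h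
  rw [matrixMean, show ∑ β : Fin L → Fin L → Bool, (if β a b then (1 : ℝ) else -1) = 0 by linarith,
    mul_zero]

/-- The mean over the sequences of sign rounds for the item pairs `ps`, with independent uniformly
random matrices in which the product sets given by `H` are planted. -/
noncomputable def roundMean (H : Fin n → Fin L → Bool) :
    List (ItemPair n) → (List (Round n L) → ℝ) → ℝ
  | [], f => f []
  | p :: ps, f => matrixMean fun β => roundMean H ps fun rs => f (signRound p (plant H p β) :: rs)

variable {H : Fin n → Fin L → Bool}

theorem roundMean_const (ps : List (ItemPair n)) (c : ℝ) : roundMean H ps (fun _ => c) = c := by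
  induction ps with
  | nil => rfl
  | cons p ps ih => simp only [roundMean, ih, matrixMean_const]

theorem roundMean_add (ps : List (ItemPair n)) (f g : List (Round n L) → ℝ) :
    (roundMean H ps fun rs => f rs + g rs) = roundMean H ps f + roundMean H ps g := by
  induction ps generalizing f g with
  | nil => rfl
  | cons p ps ih => simp only [roundMean, ih, matrixMean_add]

theorem roundMean_const_mul (ps : List (ItemPair n)) (c : ℝ) (f : List (Round n L) → ℝ) :
    (roundMean H ps fun rs => c * f rs) = c * roundMean H ps f := by
  induction ps generalizing f with
  | nil => rfl
  | cons p ps ih => simp only [roundMean, ih, matrixMean_const_mul]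

theorem roundMean_sub (ps : List (ItemPair n)) (f g : List (Round n L) → ℝ) :
    (roundMean H ps fun rs => f rs - g rs) = roundMean H ps f - roundMean H ps g := by
  have := roundMean_add (H := H) ps (fun rs => f rs - g rs) g
  simp only [sub_add_cancel] at this
  exact eq_sub_of_add_eq this.symm

/-- `rs` is a sequence of sign rounds for the item pairs `ps`. -/
def IsSign (rs : List (Round n L)) (ps : List (ItemPair n)) : Prop :=
  List.Forall₂ (fun r p => ∃ w, r = signRound p w) rs ps

theorem roundMean_mono {ps : List (ItemPair n)} {f g : List (Round n L) → ℝ}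
    (h : ∀ rs, IsSign rs ps → f rs ≤ g rs) : roundMean H ps f ≤ roundMean H ps g := by
  induction ps generalizing f g with
  | nil => exact h [] .nil
  | cons p ps ih => exact matrixMean_mono fun β => ih fun rs hrs => h _ (.cons ⟨_, rfl⟩ hrs)

theorem ev_roundMean {α : Type*} {μ : PMF α} (h : μ.support.Finite) (ps : List (ItemPair n))
    (f : List (Round n L) → α → ℝ) :
    (μ.ev fun a => roundMean H ps fun rs => f rs a) = roundMean H ps fun rs => μ.ev (f rs) := by
  induction ps generalizing f with
  | nil => rfl
  | cons p ps ih => simp only [roundMean, ev_matrixMean h, ih]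

/-- Whether both labels of an answer belong to the planted set (`1` or `0`). -/
def hit (H : Fin n → Fin L → Bool) (r : Round n L) (a b : ℕ) : ℚ :=
  if h : a < L ∧ b < L then (if H r.fst ⟨a, h.1⟩ && H r.snd ⟨b, h.2⟩ then 1 else 0) else 0

/-- The joint distribution of the total payoff and the total number of hits. -/
noncomputable def Learner.trace (A : Learner) (t : ℕ) (H : Fin n → Fin L → Bool) :
    List (Round n L) → Mem → PMF (ℚ × ℚ)
  | [], _ => PMF.pure 0
  | r :: rs, σ =>
    (exec t A.predict (r.ask σ)).bind fun τ =>
    (exec t A.update (r.reveal τ)).bind fun υ =>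
    (A.trace t H rs υ).map fun x =>
      (r.reward (label₁ τ) (label₂ τ) + x.1, hit H r (label₁ τ) (label₂ τ) + x.2)

variable (A : Learner) (t : ℕ)

/-- The hits are only recorded and never influence the play, so forgetting them recovers the
original payoff law. -/
theorem map_fst_trace (rs : List (Round n L)) (σ : Mem) :
    (A.trace t H rs σ).map Prod.fst = A.play t rs σ := by
  induction rs generalizing σ with
  | nil => simp [Learner.trace, Learner.play, PMF.pure_map]
  | cons r rs ih =>
    simp only [Learner.trace, Learner.play, PMF.map_bind, PMF.map_comp, ← ih]
    rfl

theorem finite_support_trace (rs : List (Round n L)) (σ : Mem) :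
    (A.trace t H rs σ).support.Finite := by
  induction rs generalizing σ with
  | nil => simp [Learner.trace]
  | cons r rs ih =>
    simp only [Learner.trace, PMF.support_bind, PMF.support_map]
    exact (finite_support_exec _ _ _).biUnion fun τ _ =>
      (finite_support_exec _ _ _).biUnion fun υ _ => (ih υ).image _

theorem ev_play (rs : List (Round n L)) (σ : Mem) (f : ℚ → ℝ) :
    (A.play t rs σ).ev f = (A.trace t H rs σ).ev fun x => f x.1 := by
  rw [← map_fst_trace A t (H := H), PMF.ev_map (finite_support_trace A t rs σ)]

theorem finite_support_play (rs : List (Round n L)) (σ : Mem) :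
    (A.play t rs σ).support.Finite := by
  rw [← map_fst_trace A t (H := fun _ _ => false), PMF.support_map]
  exact (finite_support_trace A t rs σ).image _

theorem ev_trace_cons (r : Round n L) (rs : List (Round n L)) (σ : Mem) (f : ℚ × ℚ → ℝ) :
    (A.trace t H (r :: rs) σ).ev f =
      (exec t A.predict (r.ask σ)).ev fun τ => (exec t A.update (r.reveal τ)).ev fun υ =>
        (A.trace t H rs υ).ev fun x =>
          f (r.reward (label₁ τ) (label₂ τ) + x.1, hit H r (label₁ τ) (label₂ τ) + x.2) := by
  have h : ∀ τ, ((exec t A.update (r.reveal τ)).bind fun υ => (A.trace t H rs υ).map fun x =>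
      (r.reward (label₁ τ) (label₂ τ) + x.1,
        hit H r (label₁ τ) (label₂ τ) + x.2)).support.Finite := by
    intro τ
    simp only [PMF.support_bind, PMF.support_map]
    exact (finite_support_exec _ _ _).biUnion fun υ _ => (finite_support_trace A t rs υ).image _
  rw [Learner.trace, PMF.ev_bind (finite_support_exec _ _ _) h]
  congr 1
  funext τ
  rw [PMF.ev_bind (finite_support_exec _ _ _)]
  · congr 1
    funext υ
    rw [PMF.ev_map (finite_support_trace A t rs υ)]
  · intro υ
    rw [PMF.support_map]
    exact (finite_support_trace A t rs υ).image _

/-- The payoff of an answer minus the indicator of a hit. -/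
noncomputable def excess (H : Fin n → Fin L → Bool) (r : Round n L) (τ : Mem) : ℝ :=
  (r.reward (label₁ τ) (label₂ τ) : ℝ) - hit H r (label₁ τ) (label₂ τ)

theorem payoff_plant (p : ItemPair n) (β : Fin L → Fin L → Bool) (a b : Fin L) :
    (((signRound p (plant H p β)).payoff a b : ℚ) : ℝ) =
      if H p.1.1 a && H p.1.2 b then 1 else if β a b then 1 else -1 := by
  by_cases h : (H p.1.1 a && H p.1.2 b) = true
  · simp only [signRound, plant, h, Bool.or_true, if_true, Rat.cast_one]
  · rw [Bool.not_eq_true] at h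
    simp only [signRound, plant, h, Bool.or_false, Bool.false_eq_true, if_false]
    split_ifs <;> simp

/-- A planted entry is always `1` and any other entry is a fair sign, so the mean payoff is exactly
the indicator of a hit. This is the compensator of the martingale. -/
theorem matrixMean_payoff (p : ItemPair n) (a b : Fin L) :
    (matrixMean fun β => (((signRound p (plant H p β)).payoff a b : ℚ) : ℝ)) =
      if H p.1.1 a && H p.1.2 b then 1 else 0 := by
  simp only [payoff_plant]
  split_ifs
  · exact matrixMean_const 1
  · exact matrixMean_sign a b

theorem excess_eq_of_lt (r : Round n L) {τ : Mem} (h : label₁ τ < L ∧ label₂ τ < L) :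
    excess H r τ = ((r.payoff ⟨_, h.1⟩ ⟨_, h.2⟩ : ℚ) : ℝ) +
      -(if H r.fst ⟨_, h.1⟩ && H r.snd ⟨_, h.2⟩ then 1 else 0) := by
  simp only [excess, Round.reward, hit, dif_pos h, sub_eq_add_neg]
  split_ifs <;> simp

theorem excess_eq (p : ItemPair n) (w : Fin L → Fin L → Bool) {τ : Mem}
    (h : label₁ τ < L ∧ label₂ τ < L) :
    excess H (signRound p w) τ =
      (((signRound p w).payoff ⟨_, h.1⟩ ⟨_, h.2⟩ : ℚ) : ℝ) +
        -(if H p.1.1 ⟨_, h.1⟩ && H p.1.2 ⟨_, h.2⟩ then 1 else 0) :=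
  excess_eq_of_lt _ h

theorem excess_eq_zero (r : Round n L) {τ : Mem} (h : ¬(label₁ τ < L ∧ label₂ τ < L)) :
    excess H r τ = 0 := by
  simp [excess, Round.reward, hit, h]

theorem matrixMean_excess (p : ItemPair n) (τ : Mem) :
    (matrixMean fun β => excess H (signRound p (plant H p β)) τ) = 0 := by
  by_cases h : label₁ τ < L ∧ label₂ τ < L
  · simp only [excess_eq p _ h, matrixMean_add, matrixMean_payoff, matrixMean_const, add_neg_cancel]
  · simp only [excess_eq_zero _ h, matrixMean_const]

/-- On a hit the payoff `1` cancels against the indicator; otherwise the excess is `±1`, or `0` for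
an answer that is not a pair of labels. -/
theorem excess_sq_le (p : ItemPair n) (β : Fin L → Fin L → Bool) (τ : Mem) :
    excess H (signRound p (plant H p β)) τ ^ 2 ≤ 1 := by
  by_cases h : label₁ τ < L ∧ label₂ τ < L
  · rw [excess_eq p _ h, payoff_plant]
    split_ifs <;> simp
  · simp [excess_eq_zero _ h]

/-- The prediction sees only the items, never the payoff matrix, so the average over the first
matrix can be moved inside the expectation over the prediction. The all-`false` matrix is a dummy:
`ask` ignores it. -/
theorem roundMean_trace_cons (p : ItemPair n) (ps : List (ItemPair n)) (σ : Mem)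
    (f : ℚ × ℚ → ℝ) :
    (roundMean H (p :: ps) fun rs => (A.trace t H rs σ).ev f) =
      (exec t A.predict ((signRound (L := L) p fun _ _ => false).ask σ)).ev fun τ =>
        matrixMean fun β =>
          (exec t A.update ((signRound p (plant H p β)).reveal τ)).ev fun υ =>
            roundMean H ps fun rs => (A.trace t H rs υ).ev fun x =>
              f ((signRound p (plant H p β)).reward (label₁ τ) (label₂ τ) + x.1,
                hit H (signRound p (plant H p β)) (label₁ τ) (label₂ τ) + x.2) := by
  rw [ev_matrixMean (finite_support_exec _ _ _), roundMean]
  congr 1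
  funext β
  simp only [ev_trace_cons, ev_roundMean (finite_support_exec _ _ _)]
  rfl

/-- The remaining rounds have mean excess zero from any memory by induction, and the first one does
for each fixed answer by `matrixMean_excess`. Quantifying over all memories stands in for
conditioning on the past. -/
theorem roundMean_excess (ps : List (ItemPair n)) (σ : Mem) :
    (roundMean H ps fun rs => (A.trace t H rs σ).ev fun x => (x.1 : ℝ) - x.2) = 0 := by
  induction ps generalizing σ with
  | nil => simp [roundMean, Learner.trace, PMF.ev_pure]
  | cons p ps ih =>
    rw [roundMean_trace_cons]
    have key : ∀ (τ : Mem) (β : Fin L → Fin L → Bool) (υ : Mem),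
        (roundMean H ps fun rs => (A.trace t H rs υ).ev fun x =>
          (((signRound p (plant H p β)).reward (label₁ τ) (label₂ τ) + x.1 : ℚ) : ℝ) -
            ((hit H (signRound p (plant H p β)) (label₁ τ) (label₂ τ) + x.2 : ℚ) : ℝ)) =
        excess H (signRound p (plant H p β)) τ := by
      intro τ β υ
      have : ∀ rs, ((A.trace t H rs υ).ev fun x =>
          (((signRound p (plant H p β)).reward (label₁ τ) (label₂ τ) + x.1 : ℚ) : ℝ) -
            ((hit H (signRound p (plant H p β)) (label₁ τ) (label₂ τ) + x.2 : ℚ) : ℝ)) =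
          excess H (signRound p (plant H p β)) τ +
            (A.trace t H rs υ).ev fun x => (x.1 : ℝ) - x.2 := by
        intro rs
        rw [← PMF.ev_const (A.trace t H rs υ) (excess H (signRound p (plant H p β)) τ),
          ← PMF.ev_add (finite_support_trace A t rs υ)]
        congr 1
        funext x
        simp only [excess]
        push_cast
        ring
      simp only [this, roundMean_add, roundMean_const, ih, add_zero]
    simp only [key, PMF.ev_const, matrixMean_excess]

/-- Orthogonality of martingale increments: with `z` the excess of the first round, the cross term
in the expanded square vanishes because the later rounds have mean excess zero from every memory.
Each round thus adds at most 1. -/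
theorem roundMean_excess_sq (ps : List (ItemPair n)) (σ : Mem) :
    (roundMean H ps fun rs => (A.trace t H rs σ).ev fun x => ((x.1 : ℝ) - x.2) ^ 2) ≤
      ps.length := by
  induction ps generalizing σ with
  | nil => simp [roundMean, Learner.trace, PMF.ev_pure]
  | cons p ps ih =>
    rw [roundMean_trace_cons]
    have key : ∀ (τ : Mem) (β : Fin L → Fin L → Bool) (υ : Mem),
        (roundMean H ps fun rs => (A.trace t H rs υ).ev fun x =>
          ((((signRound p (plant H p β)).reward (label₁ τ) (label₂ τ) + x.1 : ℚ) : ℝ) -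
            ((hit H (signRound p (plant H p β)) (label₁ τ) (label₂ τ) + x.2 : ℚ) : ℝ)) ^ 2) ≤
        (p :: ps).length := by
      intro τ β υ
      set z := excess H (signRound p (plant H p β)) τ with hz
      have : ∀ rs, ((A.trace t H rs υ).ev fun x =>
          ((((signRound p (plant H p β)).reward (label₁ τ) (label₂ τ) + x.1 : ℚ) : ℝ) -
            ((hit H (signRound p (plant H p β)) (label₁ τ) (label₂ τ) + x.2 : ℚ) : ℝ)) ^ 2) =
          (z ^ 2 + 2 * z * (A.trace t H rs υ).ev fun x => (x.1 : ℝ) - x.2) +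
            (A.trace t H rs υ).ev fun x => ((x.1 : ℝ) - x.2) ^ 2 := by
        intro rs
        rw [← PMF.ev_const (A.trace t H rs υ) (z ^ 2), ← PMF.ev_const_mul,
          ← PMF.ev_add (finite_support_trace A t rs υ),
          ← PMF.ev_add (finite_support_trace A t rs υ)]
        congr 1
        funext x
        simp only [hz, excess]
        push_cast
        ring
      simp only [this, roundMean_add, roundMean_const, roundMean_const_mul, roundMean_excess,
        mul_zero, add_zero, List.length_cons, Nat.cast_add, Nat.cast_one]
      linarith [ih υ, excess_sq_le (H := H) p β τ]
    calc _ ≤ (exec t A.predict ((signRound (L := L) p fun _ _ => false).ask σ)).ev fun τ =>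
        matrixMean fun β : Fin L → Fin L → Bool =>
          (exec t A.update ((signRound p (plant H p β)).reveal τ)).ev fun υ =>
            (((p :: ps).length : ℕ) : ℝ) := by
          refine PMF.ev_mono (finite_support_exec _ _ _) fun τ _ => matrixMean_mono fun β =>
            PMF.ev_mono (finite_support_exec _ _ _) fun υ _ => key τ β υ
      _ = _ := by simp only [PMF.ev_const, matrixMean_const]

/-- The number of item pairs for which the labeling `l` hits the planted set. -/
def hitPairs (H : Fin n → Fin L → Bool) (l : Fin n → Fin L) (ps : List (ItemPair n)) : ℕ :=
  ps.countP fun p => H p.1.1 (l p.1.1) && H p.1.2 (l p.1.2)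

theorem le_opt (rs : List (Round n L)) (l : Fin n → Fin L) :
    (rs.map fun r => (r.payoff (l r.fst) (l r.snd) : ℝ)).sum ≤ opt rs :=
  le_ciSup (f := fun l : Fin n → Fin L => (rs.map fun r => (r.payoff (l r.fst) (l r.snd) : ℝ)).sum)
    (Set.finite_range _).bddAbove l

/-- A fixed labeling earns on average one per pair it hits. Together with `le_opt` this bounds the
mean of the optimum from below. -/
theorem hitPairs_eq_roundMean (l : Fin n → Fin L) (ps : List (ItemPair n)) :
    (roundMean H ps fun rs => (rs.map fun r => (r.payoff (l r.fst) (l r.snd) : ℝ)).sum) =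
      hitPairs H l ps := by
  induction ps with
  | nil => simp [roundMean, hitPairs]
  | cons p ps ih =>
    have hc : ∀ (w : Fin L → Fin L → Bool) (rs : List (Round n L)),
        ((signRound p w :: rs).map fun r => (r.payoff (l r.fst) (l r.snd) : ℝ)).sum =
          (((signRound p w).payoff (l p.1.1) (l p.1.2) : ℚ) : ℝ) +
            (rs.map fun r => (r.payoff (l r.fst) (l r.snd) : ℝ)).sum := by
      intro w rs
      rw [List.map_cons, List.sum_cons]
      rfl
    simp only [roundMean, hc, roundMean_add, roundMean_const, ih, matrixMean_add,
      matrixMean_const, matrixMean_payoff]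
    simp only [hitPairs, List.countP_cons, Nat.cast_add, Nat.cast_ite, Nat.cast_one, Nat.cast_zero,
      add_comm]

/-- Under `hl`, the labeling `l` hits every pair that any answer could hit, so `M` bounds the hits
on every run and not only on average. This is what permits Markov's inequality for the shortfall. -/
theorem hits_le {l : Fin n → Fin L} (hl : ∀ i a, H i a → H i (l i)) {rs : List (Round n L)}
    {ps : List (ItemPair n)} (h : IsSign rs ps) (σ : Mem) :
    ∀ x ∈ (A.trace t H rs σ).support, (x.2 : ℝ) ≤ hitPairs H l ps := by
  induction h generalizing σ with
  | nil => simp [Learner.trace, hitPairs]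
  | @cons r p rs ps hr hrs ih =>
    obtain ⟨w, rfl⟩ := hr
    intro x hx
    simp only [Learner.trace, PMF.mem_support_bind_iff, PMF.mem_support_map_iff] at hx
    obtain ⟨τ, -, υ, -, y, hy, rfl⟩ := hx
    have h1 := ih υ y hy
    have h2 : (hit H (signRound p w) (label₁ τ) (label₂ τ) : ℝ) ≤
        if H p.1.1 (l p.1.1) && H p.1.2 (l p.1.2) then 1 else 0 := by
      unfold hit
      split_ifs with ha hb hc hc
      · simp
      · simp only [Bool.and_eq_true, signRound] at hb hc
        exact absurd ⟨hl _ _ hb.1, hl _ _ hb.2⟩ hc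
      all_goals simp
    simp only [hitPairs, List.countP_cons] at h1 ⊢
    push_cast
    refine (add_le_add h2 h1).trans (le_of_eq ?_)
    split_ifs <;> simp [add_comm]

/-- Without planting, the total payoff of any learner is unlikely to be large. -/
theorem roundMean_random_le (ps : List (ItemPair n)) (σ : Mem) {θ : ℝ} (hθ : 0 < θ) :
    (roundMean (fun _ _ => false : Fin n → Fin L → Bool) ps fun rs =>
      (A.play t rs σ).ev fun x => if θ ≤ (x : ℝ) then 1 else 0) ≤ ps.length / θ ^ 2 := by
  set H : Fin n → Fin L → Bool := fun _ _ => false with hH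
  -- Nothing is planted, so there are no hits and the excess is the payoff itself.
  have h0 : ∀ rs, IsSign rs ps → ∀ x ∈ (A.trace t H rs σ).support, x.2 = 0 := by
    intro rs hrs
    clear * - hH
    induction rs generalizing σ with
    | nil => simp [Learner.trace]
    | cons r rs ih =>
      intro x hx
      simp only [Learner.trace, PMF.mem_support_bind_iff, PMF.mem_support_map_iff] at hx
      obtain ⟨τ, -, υ, -, y, hy, rfl⟩ := hx
      simp [ih υ y hy, hit, hH]
  -- Chebyshev: `θ²` times the indicator is at most the square of the payoff.
  rw [le_div_iff₀ (by positivity), mul_comm, ← roundMean_const_mul]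
  refine (roundMean_mono fun rs hrs => ?_).trans (roundMean_excess_sq A t (H := H) ps σ)
  rw [ev_play A t (H := H), ← PMF.ev_const_mul]
  refine PMF.ev_mono (finite_support_trace A t rs σ) fun x hx => ?_
  rw [h0 rs hrs x hx]
  split_ifs with h
  · simp only [Rat.cast_zero, sub_zero, mul_one]
    exact pow_le_pow_left₀ hθ.le h 2
  · simp only [mul_zero]
    positivity

/-- With planting, a learner of small regret is likely to obtain a large total payoff. -/
theorem roundMean_planted_le {l : Fin n → Fin L} (hl : ∀ i a, H i a → H i (l i))
    (ps : List (ItemPair n)) (σ : Mem) {R θ : ℝ} (hR : 0 < R) (hθ : 0 < θ)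
    (hreg : ∀ rs : List (Round n L), IsSign rs ps → opt rs - (A.play t rs σ).ev (fun x => (x : ℝ)) ≤ R)
    (hM : 20 * R + 3 * θ ≤ hitPairs H l ps) :
    (roundMean H ps fun rs => (A.play t rs σ).ev fun x => if (x : ℝ) < θ then 1 else 0) ≤
      1 / 20 + ps.length / (4 * θ ^ 2) := by
  set M : ℝ := ((hitPairs H l ps : ℕ) : ℝ) with hMdef
  have h1 : M ≤ roundMean H ps fun rs => opt rs := by
    rw [hMdef, ← hitPairs_eq_roundMean]
    exact roundMean_mono fun rs _ => le_opt rs l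
  have h2 : (roundMean H ps fun rs => opt rs - (A.play t rs σ).ev (fun x => (x : ℝ))) ≤ R :=
    (roundMean_mono hreg).trans (roundMean_const ps R).le
  rw [roundMean_sub] at h2
  -- The mean excess is zero, so the regret bound on payoffs becomes one on hits.
  have h3 : (roundMean H ps fun rs => (A.play t rs σ).ev (fun x => (x : ℝ))) =
      roundMean H ps fun rs => (A.trace t H rs σ).ev (fun x => (x.2 : ℝ)) := by
    have := roundMean_excess A t (H := H) ps σ
    simp only [PMF.ev_sub (finite_support_trace A t _ σ), roundMean_sub] at this
    simp only [ev_play A t (H := H)]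
    linarith
  -- If the payoff is below `θ`, either the hits are at most `M - 20 * R` and the Markov term is at
  -- least 1, or they exceed `3 * θ`, the excess is below `-2 * θ`, and the Chebyshev term is at
  -- least 1.
  calc _ ≤ roundMean H ps fun rs => (A.trace t H rs σ).ev fun x =>
        (20 * R)⁻¹ * (M - x.2) + (4 * θ ^ 2)⁻¹ * ((x.1 : ℝ) - x.2) ^ 2 := by
        refine roundMean_mono fun rs hrs => ?_
        rw [ev_play A t (H := H)]
        refine PMF.ev_mono (finite_support_trace A t rs σ) fun x hx => ?_
        have hxM := hits_le A t hl hrs σ x hx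
        have p1 : 0 ≤ (20 * R)⁻¹ * (M - x.2) := mul_nonneg (by positivity) (by linarith)
        have p2 : 0 ≤ (4 * θ ^ 2)⁻¹ * ((x.1 : ℝ) - x.2) ^ 2 := by positivity
        split_ifs with h
        · by_cases hb : (x.2 : ℝ) ≤ M - 20 * R
          · have : 1 ≤ (20 * R)⁻¹ * (M - x.2) := by
              rw [inv_mul_eq_div, le_div_iff₀ (by positivity)]
              linarith
            linarith
          · have : 1 ≤ (4 * θ ^ 2)⁻¹ * ((x.1 : ℝ) - x.2) ^ 2 := by
              rw [inv_mul_eq_div, le_div_iff₀ (by positivity)]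
              nlinarith
            linarith
        · linarith
    _ = (20 * R)⁻¹ * (M - roundMean H ps fun rs => (A.trace t H rs σ).ev (fun x => (x.2 : ℝ))) +
        (4 * θ ^ 2)⁻¹ *
          roundMean H ps fun rs => (A.trace t H rs σ).ev fun x => ((x.1 : ℝ) - x.2) ^ 2 := by
        simp only [PMF.ev_add (finite_support_trace A t _ σ), PMF.ev_const_mul,
          PMF.ev_sub (finite_support_trace A t _ σ), roundMean_add, roundMean_const_mul,
          PMF.ev_const, roundMean_sub, roundMean_const]
    _ ≤ (20 * R)⁻¹ * R + (4 * θ ^ 2)⁻¹ * ps.length := by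
        gcongr
        · linarith
        · exact roundMean_excess_sq A t ps σ
    _ = 1 / 20 + ps.length / (4 * θ ^ 2) := by
        field_simp

end OnlineLocal

/-! ### The uniform random graph and its blocks -/

namespace PlantedClique

open RAM OnlineLocal

instance (n : ℕ) : MeasurableSingletonClass (SimpleGraph (Fin n)) where
  measurableSet_singleton G := by
    have h : ({G} : Set (SimpleGraph (Fin n))) =
        SimpleGraph.edgeSet ⁻¹' {G.edgeSet} := by
      ext G'
      simp
    rw [h]
    exact SimpleGraph.measurableEmbedding_edgeSet.measurable (measurableSet_singleton _)

/-- The mean over all graphs on `N` labelled vertices. -/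
noncomputable def graphMean {N : ℕ} (f : SimpleGraph (Fin N) → ℝ) : ℝ :=
  (Fintype.card (SimpleGraph (Fin N)) : ℝ)⁻¹ * ∑ G, f G

theorem randomGraph_singleton {N : ℕ} (G : SimpleGraph (Fin N)) :
    randomGraph N {G} = (2⁻¹ : ℝ≥0∞) ^ N.choose 2 := by
  have h : (unitInterval.toNNReal ⟨1 / 2, by norm_num, by norm_num⟩ : NNReal) = 2⁻¹ := by
    ext; simp
  have h' : (unitInterval.toNNReal (unitInterval.symm ⟨1 / 2, by norm_num, by norm_num⟩) :
      NNReal) = 2⁻¹ := by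
    ext; norm_num
  have hle : G.edgeSet.ncard ≤ N.choose 2 := by
    classical
    have := G.card_edgeFinset_le_card_choose_two
    rwa [Fintype.card_fin, ← Set.ncard_coe_finset, SimpleGraph.coe_edgeFinset] at this
  rw [randomGraph, SimpleGraph.binomialRandom_singleton, h, h', ← pow_add, Nat.card_fin,
    Nat.add_sub_cancel' hle]
  simp

/-- At edge probability 1/2 edges and non-edges contribute equal factors, so all graphs have the
same mass. Integrals thereby become counting averages, which bijections of the set of graphs
preserve. -/
theorem randomGraph_singleton_eq {N : ℕ} (G : SimpleGraph (Fin N)) :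
    randomGraph N {G} = (Fintype.card (SimpleGraph (Fin N)) : ℝ≥0∞)⁻¹ := by
  have : IsProbabilityMeasure (randomGraph N) := by unfold randomGraph; infer_instance
  have h1 : ∑ G : SimpleGraph (Fin N), randomGraph N {G} = 1 := by
    simp
  simp only [randomGraph_singleton, Finset.sum_const, Finset.card_univ, nsmul_eq_mul] at h1 ⊢
  rw [← one_mul ((2⁻¹ : ℝ≥0∞) ^ _)] at *
  exact ENNReal.eq_inv_of_mul_eq_one_left (by rw [one_mul] at *; rw [mul_comm]; exact h1)

theorem lintegral_randomGraph {N : ℕ} {F : SimpleGraph (Fin N) → ℝ≥0∞} (hF : ∀ G, F G ≠ ⊤) :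
    ∫⁻ G, F G ∂(randomGraph N) = ENNReal.ofReal (graphMean fun G => (F G).toReal) := by
  rw [lintegral_fintype, graphMean, ENNReal.ofReal_mul (by positivity),
    ENNReal.ofReal_sum_of_nonneg (fun _ _ => ENNReal.toReal_nonneg), mul_comm, Finset.sum_mul,
    ENNReal.ofReal_inv_of_pos (Nat.cast_pos.2 Fintype.card_pos), ENNReal.ofReal_natCast]
  exact Finset.sum_congr rfl fun G _ => by
    rw [ENNReal.ofReal_toReal (hF G), randomGraph_singleton_eq]

theorem graphMean_const {N : ℕ} (c : ℝ) : graphMean (fun _ : SimpleGraph (Fin N) => c) = c := by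
  have : (Fintype.card (SimpleGraph (Fin N)) : ℝ) ≠ 0 := Nat.cast_ne_zero.2 Fintype.card_ne_zero
  rw [graphMean, Finset.sum_const, nsmul_eq_mul, Finset.card_univ, ← mul_assoc,
    inv_mul_cancel₀ this, one_mul]

section Blocks

variable {N n L : ℕ} (vert : Fin n → Fin L → Fin N)

open scoped Classical in
/-- The adjacency matrix between the vertices assigned to two items. -/
noncomputable def block (G : SimpleGraph (Fin N)) (p : ItemPair n) : Fin L → Fin L → Bool :=
  fun a b => decide (G.Adj (vert p.1.1 a) (vert p.1.2 b))

/-- The rounds with payoffs `±1` given by the adjacency of the vertices assigned to the items. -/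
noncomputable def graphRounds (G : SimpleGraph (Fin N)) (ps : List (ItemPair n)) :
    List (Round n L) :=
  ps.map fun p => signRound p (block vert G p)

/-- The bipartite graph with the given adjacency matrix. -/
def blockGraph (p : ItemPair n) (β : Fin L → Fin L → Bool) : SimpleGraph (Fin N) :=
  SimpleGraph.fromRel fun u v => ∃ a b, β a b = true ∧ u = vert p.1.1 a ∧ v = vert p.1.2 b

variable {vert}

theorem block_eq_true (G : SimpleGraph (Fin N)) (p : ItemPair n) (a b : Fin L) :
    block vert G p a b = true ↔ G.Adj (vert p.1.1 a) (vert p.1.2 b) := by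
  simp only [block, decide_eq_true_eq]

theorem blockGraph_adj_self (hv : Function.Injective fun x : Fin n × Fin L => vert x.1 x.2)
    (p : ItemPair n) (β : Fin L → Fin L → Bool) (a b : Fin L) :
    (blockGraph vert p β).Adj (vert p.1.1 a) (vert p.1.2 b) ↔ β a b = true := by
  have inj : ∀ i a j b, vert i a = vert j b ↔ i = j ∧ a = b := fun i a j b =>
    ⟨fun h => by simpa using hv (a₁ := (i, a)) (a₂ := (j, b)) h, by rintro ⟨rfl, rfl⟩; rfl⟩
  have := p.2
  simp only [blockGraph, SimpleGraph.fromRel_adj, inj, ne_eq]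
  constructor
  · rintro ⟨-, ⟨a', b', h, ⟨-, rfl⟩, -, rfl⟩ | ⟨a', b', h, ⟨h1, -⟩, -⟩⟩
    · exact h
    · exact absurd h1.symm this
  · intro h
    exact ⟨fun h => this h.1, .inl ⟨a, b, h, by simp⟩⟩

/-- Injectivity of `vert` lets a vertex determine its item. The item pairs must differ as unordered
pairs, since a reversed pair would share the block in transposed form. -/
theorem blockGraph_not_adj (hv : Function.Injective fun x : Fin n × Fin L => vert x.1 x.2)
    {p q : ItemPair n} (hpq : s(p.1.1, p.1.2) ≠ s(q.1.1, q.1.2)) (β : Fin L → Fin L → Bool)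
    (a b : Fin L) : ¬(blockGraph vert p β).Adj (vert q.1.1 a) (vert q.1.2 b) := by
  have inj : ∀ i a j b, vert i a = vert j b ↔ i = j ∧ a = b := fun i a j b =>
    ⟨fun h => by simpa using hv (a₁ := (i, a)) (a₂ := (j, b)) h, by rintro ⟨rfl, rfl⟩; rfl⟩
  simp only [blockGraph, SimpleGraph.fromRel_adj, inj, ne_eq]
  rintro ⟨-, ⟨a', b', h, ⟨h1, -⟩, h2, -⟩ | ⟨a', b', h, ⟨h1, -⟩, h2, -⟩⟩
  · exact hpq (by rw [h1, h2])
  · exact hpq (by rw [h1, h2, Sym2.eq_swap])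

theorem block_symmDiff_self (hv : Function.Injective fun x : Fin n × Fin L => vert x.1 x.2)
    (G : SimpleGraph (Fin N)) (p : ItemPair n) (β : Fin L → Fin L → Bool) :
    block vert (symmDiff G (blockGraph vert p β)) p = fun a b => xor (block vert G p a b) (β a b) := by
  funext a b
  rw [Bool.eq_iff_iff]
  have h := block_eq_true (vert := vert) G p a b
  simp only [block_eq_true, symmDiff, SimpleGraph.sup_adj, SimpleGraph.sdiff_adj,
    blockGraph_adj_self hv]
  rw [← h]
  cases block vert G p a b <;> cases β a b <;> simp

theorem block_symmDiff_of_ne (hv : Function.Injective fun x : Fin n × Fin L => vert x.1 x.2)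
    (G : SimpleGraph (Fin N)) {p q : ItemPair n} (hpq : s(p.1.1, p.1.2) ≠ s(q.1.1, q.1.2))
    (β : Fin L → Fin L → Bool) :
    block vert (symmDiff G (blockGraph vert p β)) q = block vert G q := by
  funext a b
  rw [Bool.eq_iff_iff]
  simp only [block_eq_true, symmDiff, SimpleGraph.sup_adj, SimpleGraph.sdiff_adj,
    blockGraph_not_adj hv hpq]
  tauto

theorem graphMean_symmDiff (K : SimpleGraph (Fin N)) (f : SimpleGraph (Fin N) → ℝ) :
    (graphMean fun G => f (symmDiff G K)) = graphMean f := by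
  unfold graphMean
  congr 1
  exact Fintype.sum_bijective _ (symmDiff_left_involutive K).bijective _ _ fun G => rfl

theorem matrixMean_xor (γ : Fin L → Fin L → Bool) (f : (Fin L → Fin L → Bool) → ℝ) :
    (matrixMean fun β => f fun a b => xor (γ a b) (β a b)) = matrixMean f := by
  unfold matrixMean
  congr 1
  refine Fintype.sum_bijective (fun β a b => xor (γ a b) (β a b))
    (Function.Involutive.bijective fun β => ?_) _ _ fun β => rfl
  funext a b
  simp

theorem graphMean_matrixMean (f : SimpleGraph (Fin N) → (Fin L → Fin L → Bool) → ℝ) :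
    (graphMean fun G => matrixMean (f G)) = matrixMean fun β => graphMean fun G => f G β := by
  simp only [graphMean, matrixMean, ← Finset.mul_sum]
  rw [Finset.sum_comm, mul_left_comm]

/-- In a uniformly random graph, the blocks of distinct item pairs are independent and uniform. -/
theorem graphMean_blocks (hv : Function.Injective fun x : Fin n × Fin L => vert x.1 x.2)
    (H : Fin n → Fin L → Bool) {ps : List (ItemPair n)}
    (hps : ps.Pairwise fun p q => s(p.1.1, p.1.2) ≠ s(q.1.1, q.1.2))
    (f : List (Round n L) → ℝ) :
    (graphMean fun G => f (ps.map fun p => signRound p (plant H p (block vert G p)))) =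
      roundMean H ps f := by
  induction hps generalizing f with
  | nil => exact graphMean_const (f [])
  | @cons p ps hp _ ih =>
    -- Toggling the edges of `blockGraph vert p β` permutes the graphs; it xors `β` into the block
    -- of `p` and leaves the other blocks alone.
    have h1 : ∀ β : Fin L → Fin L → Bool, (graphMean fun G : SimpleGraph (Fin N) =>
        f ((p :: ps).map fun q => signRound q (plant H q (block vert G q)))) =
        graphMean fun G => f (signRound p (plant H p fun a b => xor (block vert G p a b) (β a b)) ::
          ps.map fun q => signRound q (plant H q (block vert G q))) := by
      intro β
      rw [← graphMean_symmDiff (blockGraph vert p β)]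
      congr 1
      funext G
      rw [List.map_cons, block_symmDiff_self hv]
      congr 2
      exact List.map_congr_left fun q hq => by rw [block_symmDiff_of_ne hv G (hp q hq)]
    -- Averaging over the toggle `β` replaces the block of `p` by a fresh uniform matrix,
    -- independent of the rest.
    rw [← matrixMean_const (L := L) (graphMean _)]
    conv_lhs => enter [1, β]; rw [h1 β]
    rw [← graphMean_matrixMean]
    have h2 : ∀ G : SimpleGraph (Fin N), (matrixMean fun β =>
        f (signRound p (plant H p fun a b => xor (block vert G p a b) (β a b)) ::
          ps.map fun q => signRound q (plant H q (block vert G q)))) = matrixMean fun β =>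
        f (signRound p (plant H p β) ::
          ps.map fun q => signRound q (plant H q (block vert G q))) := fun G =>
      matrixMean_xor (block vert G p) fun β => f (signRound p (plant H p β) ::
          ps.map fun q => signRound q (plant H q (block vert G q)))
    simp only [h2, graphMean_matrixMean, roundMean]
    congr 1
    funext β
    exact ih fun rs => f (signRound p (plant H p β) :: rs)

/-- Distinct items own distinct vertices, so the exclusion of loops in the clique is immaterial and
planting acts on each block as a product set. -/
theorem block_sup_cliqueOn (hv : Function.Injective fun x : Fin n × Fin L => vert x.1 x.2)
    (G : SimpleGraph (Fin N)) (S : Finset (Fin N)) (p : ItemPair n) :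
    block vert (G ⊔ cliqueOn S) p =
      plant (fun i a => decide (vert i a ∈ S)) p (block vert G p) := by
  funext a b
  have : vert p.1.1 a ≠ vert p.1.2 b := fun h => p.2 (by
    have := hv (a₁ := (p.1.1, a)) (a₂ := (p.1.2, b)) h
    exact (Prod.mk.inj this).1)
  rw [Bool.eq_iff_iff]
  simp only [block_eq_true, plant, SimpleGraph.sup_adj, cliqueOn, SimpleGraph.fromRel_adj,
    decide_eq_true_eq, Bool.or_eq_true, Bool.and_eq_true]
  tauto

theorem graphMean_graphRounds (hv : Function.Injective fun x : Fin n × Fin L => vert x.1 x.2)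
    (S : Finset (Fin N)) {ps : List (ItemPair n)}
    (hps : ps.Pairwise fun p q => s(p.1.1, p.1.2) ≠ s(q.1.1, q.1.2))
    (f : List (Round n L) → ℝ) :
    (graphMean fun G => f (graphRounds vert (G ⊔ cliqueOn S) ps)) =
      roundMean (fun i a => decide (vert i a ∈ S)) ps f := by
  rw [← graphMean_blocks hv _ hps]
  simp only [graphRounds, block_sup_cliqueOn hv]

theorem cliqueOn_empty : cliqueOn (∅ : Finset (Fin N)) = ⊥ := by
  ext u v
  simp [cliqueOn]

end Blocks

theorem lintegral_plantedGraph {N k : ℕ} {F : SimpleGraph (Fin N) → ℝ≥0∞} (hF : ∀ G, F G ≠ ⊤) :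
    ∫⁻ G, F G ∂(plantedGraph N k) = (N.choose k : ℝ≥0∞)⁻¹ *
      ∑ S ∈ Finset.powersetCard k (Finset.univ : Finset (Fin N)),
        ENNReal.ofReal (graphMean fun G => (F (G ⊔ cliqueOn S)).toReal) := by
  rw [plantedGraph, lintegral_smul_measure, lintegral_finsetSum_measure, smul_eq_mul]
  congr 1
  refine Finset.sum_congr rfl fun S _ => ?_
  rw [lintegral_map (measurable_of_finite _) (measurable_of_finite _),
    lintegral_randomGraph fun G => hF _]

end PlantedClique

/-! ### How many items a random vertex set meets -/

namespace PlantedClique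

variable {N n L k : ℕ}

/-- The vertex that corresponds to label `a` of item `i`. -/
def vertex (h : n * L ≤ N) (i : Fin n) (a : Fin L) : Fin N :=
  ⟨n * a + i, by
    have : n * (a + 1) ≤ n * L := Nat.mul_le_mul_left n a.2
    rw [Nat.mul_add] at this
    have := i.2
    omega⟩

theorem vertex_injective (h : n * L ≤ N) :
    Function.Injective fun x : Fin n × Fin L => vertex h x.1 x.2 := by
  rintro ⟨i, a⟩ ⟨j, b⟩ hx
  have hx' : n * (a : ℕ) + i = n * b + j := congrArg Fin.val hx
  have hn : 0 < n := i.pos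
  have h1 : (i : ℕ) = j := by
    have := congrArg (· % n) hx'
    simpa [Nat.mul_add_mod, Nat.mod_eq_of_lt] using this
  have h2 : (a : ℕ) = b := by
    rw [h1] at hx'
    exact Nat.eq_of_mul_eq_mul_left hn (by omega)
  exact Prod.ext (Fin.ext h1) (Fin.ext h2)

/-- The items some vertex of which belongs to `S`. -/
def hitItems (h : n * L ≤ N) (S : Finset (Fin N)) : Finset (Fin n) :=
  Finset.univ.filter fun i => ∃ a, vertex h i a ∈ S

/-- The pairs of vertices that correspond to the same item. -/
def collisions (N n : ℕ) : Finset (Fin N × Fin N) :=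
  Finset.univ.filter fun x => x.1 < x.2 ∧ (x.1 : ℕ) % n = (x.2 : ℕ) % n

/-- The vertices that correspond to no item. -/
def unused (N m : ℕ) : Finset (Fin N) := Finset.univ.filter fun v => m ≤ v

/-- Remove from `S` its unused vertices and the larger vertex of every colliding pair inside `S`.
The remaining vertices have distinct residues mod `n`, that is, distinct items. -/
theorem card_le_hitItems (hn : 0 < n) (h : n * L ≤ N) (S : Finset (Fin N)) :
    S.card ≤ (hitItems h S).card + ((unused N (n * L)).filter (· ∈ S)).card +
      ((collisions N n).filter fun x => {x.1, x.2} ⊆ S).card := by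
  set X := (unused N (n * L)).filter (· ∈ S)
  set Y := (collisions N n).filter fun x => {x.1, x.2} ⊆ S
  have hsub : S ⊆ (S \ (X ∪ Y.image Prod.snd)) ∪ (X ∪ Y.image Prod.snd) := by
    intro v hv
    simp [hv]
  refine (Finset.card_le_card hsub).trans ((Finset.card_union_le _ _).trans ?_)
  have h2 : (X ∪ Y.image Prod.snd).card ≤ X.card + Y.card :=
    (Finset.card_union_le _ _).trans (Nat.add_le_add_left Finset.card_image_le _)
  have h3 : (S \ (X ∪ Y.image Prod.snd)).card ≤ (hitItems h S).card := by
    refine Finset.card_le_card_of_injOn (fun v => ⟨(v : ℕ) % n, Nat.mod_lt _ hn⟩) ?_ ?_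
    · intro v hv
      simp only [Finset.coe_sdiff, Set.mem_sdiff, Finset.mem_coe, Finset.mem_union, not_or] at hv
      have hvL : (v : ℕ) < n * L := by
        by_contra hc
        exact hv.2.1 (by simp [X, unused, hv.1]; omega)
      simp only [hitItems, Finset.coe_filter, Finset.mem_univ, true_and, Set.mem_ofPred_eq]
      refine ⟨⟨v / n, Nat.div_lt_of_lt_mul hvL⟩, ?_⟩
      convert hv.1
      exact Fin.ext (Nat.div_add_mod _ _)
    · intro u hu v hv huv
      simp only [Finset.coe_sdiff, Set.mem_sdiff, Finset.mem_coe, Finset.mem_union, not_or,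
        Finset.mem_image, not_exists, not_and] at hu hv
      have huv' : (u : ℕ) % n = v % n := congrArg Fin.val huv
      by_contra hne
      rcases lt_or_gt_of_ne hne with hlt | hlt
      · refine hv.2.2 (u, v) ?_ rfl
        simp [Y, collisions, hlt, huv', Finset.insert_subset_iff, hu.1, hv.1]
      · refine hu.2.2 (v, u) ?_ rfl
        simp [Y, collisions, hlt, huv', Finset.insert_subset_iff, hu.1, hv.1]
  omega

theorem sum_card_filter_comm {α ι : Type*} (s : Finset α) (t : Finset ι) (r : α → ι → Prop)
    [∀ a, DecidablePred (r a)] [∀ i, DecidablePred fun a => r a i] :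
    ∑ a ∈ s, (t.filter (r a)).card = ∑ i ∈ t, (s.filter fun a => r a i).card := by
  simp only [Finset.card_filter]
  exact Finset.sum_comm

theorem mul_card_powersetCard_mem (v : Fin N) :
    N * ((Finset.powersetCard k Finset.univ).filter fun S : Finset (Fin N) => v ∈ S).card =
      k * N.choose k := by
  have hN := v.pos
  obtain ⟨N, rfl⟩ := Nat.exists_eq_succ_of_ne_zero hN.ne'
  rcases k with _ | k
  · simp
  · have := Finset.card_filter_powersetCard_subset {v} (Finset.univ) (k + 1) (by simp) (by simp)
    simp only [Finset.singleton_subset_iff, Finset.card_univ, Fintype.card_fin,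
      Finset.card_singleton, Nat.add_sub_cancel] at this
    rw [this]
    simpa [mul_comm] using Nat.add_one_mul_choose_eq N k

/-- Two given vertices lie in a random `k`-set with probability `k(k-1) / (N(N-1))`; replacing `k -
1` by `k` keeps the statement free of subtraction in `k`. -/
theorem mul_card_powersetCard_pair_le {u v : Fin N} (huv : u ≠ v) :
    N * (N - 1) *
      ((Finset.powersetCard k Finset.univ).filter fun S : Finset (Fin N) => {u, v} ⊆ S).card ≤
      k * k * N.choose k := by
  rcases Nat.lt_or_ge k 2 with hk | hk
  · have : ((Finset.powersetCard k Finset.univ).filter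
        fun S : Finset (Fin N) => {u, v} ⊆ S).card = 0 := by
      rw [Finset.card_eq_zero, Finset.filter_eq_empty_iff]
      intro S hS hsub
      have := Finset.card_le_card hsub
      rw [Finset.card_pair huv, (Finset.mem_powersetCard.1 hS).2] at this
      omega
    simp [this]
  · obtain ⟨k, rfl⟩ := Nat.exists_eq_add_of_le' hk
    have hN : 2 ≤ N := by
      have := Finset.card_le_univ ({u, v} : Finset (Fin N))
      rwa [Finset.card_pair huv, Fintype.card_fin] at this
    obtain ⟨N, rfl⟩ := Nat.exists_eq_add_of_le' hN
    have := Finset.card_filter_powersetCard_subset {u, v} (Finset.univ) (k + 2) (by simp)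
      (by rw [Finset.card_pair huv]; omega)
    simp only [Finset.card_univ, Fintype.card_fin, Finset.card_pair huv, Nat.add_sub_cancel] at this
    rw [this]
    have e1 := Nat.add_one_mul_choose_eq (N + 1) (k + 1)
    have e2 := Nat.add_one_mul_choose_eq N k
    calc (N + 2) * (N + 2 - 1) * N.choose k = (N + 2) * ((N + 1) * N.choose k) := by
          rw [mul_assoc]; rfl
      _ = (k + 1) * ((N + 1 + 1) * (N + 1).choose (k + 1)) := by rw [e2]; ring
      _ = (k + 1) * (k + 2) * (N + 2).choose (k + 2) := by rw [e1]; ring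
      _ ≤ (k + 2) * (k + 2) * (N + 2).choose (k + 2) := by gcongr; omega

/-- A colliding pair `u < v` is determined by `v` and the quotient of `u` by `n`, because the
residue is shared. That quotient is strictly below `N / n`. -/
theorem mul_card_collisions_le (N n : ℕ) : n * (collisions N n).card ≤ N * N := by
  have : (collisions N n).card ≤ (Finset.univ ×ˢ Finset.range (N / n) :
      Finset (Fin N × ℕ)).card := by
    refine Finset.card_le_card_of_injOn (fun x => (x.2, (x.1 : ℕ) / n)) ?_ ?_
    · rintro ⟨u, v⟩ hx
      simp only [collisions, Finset.coe_filter, Finset.mem_univ, true_and, Set.mem_ofPred_eq] at hx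
      simp only [Finset.coe_product, Finset.coe_univ, Finset.coe_range, Set.mem_prod, Set.mem_univ,
        Set.mem_Iio, true_and]
      have h1 : (v : ℕ) / n ≤ N / n := Nat.div_le_div_right v.2.le
      have h2 := Nat.div_add_mod (u : ℕ) n
      have h3 := Nat.div_add_mod (v : ℕ) n
      have h4 : (u : ℕ) < v := hx.1
      by_contra hc
      have : n * ((v : ℕ) / n) ≤ n * ((u : ℕ) / n) := Nat.mul_le_mul_left n (by omega)
      omega
    · rintro ⟨u, v⟩ hx ⟨u', v'⟩ hx' hxx
      simp only [collisions, Finset.coe_filter, Finset.mem_univ, true_and,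
        Set.mem_ofPred_eq] at hx hx'
      simp only [Prod.mk.injEq] at hxx
      obtain ⟨rfl, h1⟩ := hxx
      have h2 := Nat.div_add_mod (u : ℕ) n
      have h3 := Nat.div_add_mod (u' : ℕ) n
      rw [h1] at h2
      simp only [Prod.mk.injEq, and_true]
      exact Fin.ext (by omega)
  rw [Finset.card_product, Finset.card_univ, Fintype.card_fin, Finset.card_range] at this
  calc n * (collisions N n).card ≤ n * (N * (N / n)) := Nat.mul_le_mul_left n this
    _ = N * (n * (N / n)) := by ring
    _ ≤ N * N := Nat.mul_le_mul_left N (Nat.mul_div_le N n)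

theorem card_unused_le (N m : ℕ) : (unused N m).card ≤ N - m := by
  have : (unused N m).card ≤ (Finset.Ico m N).card := by
    refine Finset.card_le_card_of_injOn Fin.val ?_ Fin.val_injective.injOn
    intro v hv
    simp only [unused, Finset.coe_filter, Finset.mem_univ, true_and, Set.mem_ofPred_eq] at hv
    simp [hv]
  simpa using this

/-- A random set of `k` vertices is likely to hit at least `k / 2` items. -/
theorem card_few_hits_le (h : n * L ≤ N) (hn : 0 < n) (hL : N ≤ n * L + n)
    (hN : 80 * n ≤ N) (hk : 160 * k ≤ n) :
    20 * ((Finset.powersetCard k Finset.univ).filter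
      fun S : Finset (Fin N) => 2 * (hitItems h S).card < k).card ≤ N.choose k := by
  rcases Nat.eq_zero_or_pos k with rfl | hk0
  · simp
  set P := Finset.powersetCard k (Finset.univ : Finset (Fin N)) with hP
  set C := N.choose k
  set B := P.filter fun S => 2 * (hitItems h S).card < k
  set U := ∑ S ∈ P, ((unused N (n * L)).filter (· ∈ S)).card with hU
  set V := ∑ S ∈ P, ((collisions N n).filter fun x => {x.1, x.2} ⊆ S).card with hV
  -- `U` and `V` are the expected losses to unused vertices and to collisions, multiplied by the
  -- number `C` of `k`-sets.
  have hNU : N * U ≤ n * (k * C) := by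
    rw [hU, sum_card_filter_comm, Finset.mul_sum, Finset.sum_congr rfl
      fun v _ => mul_card_powersetCard_mem v, Finset.sum_const, smul_eq_mul]
    have := card_unused_le N (n * L)
    exact Nat.mul_le_mul_right _ (by omega)
  have hNV : N * (N - 1) * V ≤ (collisions N n).card * (k * k * C) := by
    rw [hV, sum_card_filter_comm, Finset.mul_sum, ← smul_eq_mul (collisions N n).card,
      ← Finset.sum_const]
    refine Finset.sum_le_sum fun x hx => mul_card_powersetCard_pair_le ?_
    simp only [collisions, Finset.mem_filter, Finset.mem_univ, true_and] at hx
    exact hx.1.ne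
  have hNV' : n * (N - 1) * V ≤ N * (k * k * C) := by
    have hNpos : 0 < N := by omega
    refine Nat.le_of_mul_le_mul_left ?_ hNpos
    calc N * (n * (N - 1) * V) = n * (N * (N - 1) * V) := by ring
      _ ≤ n * ((collisions N n).card * (k * k * C)) := Nat.mul_le_mul_left n hNV
      _ = n * (collisions N n).card * (k * k * C) := by ring
      _ ≤ N * N * (k * k * C) := Nat.mul_le_mul_right _ (mul_card_collisions_le N n)
      _ = N * (N * (k * k * C)) := by ring
  -- Markov: a set that meets fewer than `k / 2` items has lost at least `k / 2` vertices. Since `U`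
  -- and `V` are each at most `k * C / 80`, the bad sets are at most a twentieth.
  have hB : k * B.card ≤ 2 * (U + V) := by
    calc k * B.card = ∑ S ∈ B, k := by rw [Finset.sum_const, smul_eq_mul, mul_comm]
      _ ≤ ∑ S ∈ B, 2 * (((unused N (n * L)).filter (· ∈ S)).card +
          ((collisions N n).filter fun x => {x.1, x.2} ⊆ S).card) := by
        refine Finset.sum_le_sum fun S hS => ?_
        simp only [B, P, Finset.mem_filter, Finset.mem_powersetCard] at hS
        have := card_le_hitItems hn h S
        omega
      _ ≤ ∑ S ∈ P, 2 * (((unused N (n * L)).filter (· ∈ S)).card +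
          ((collisions N n).filter fun x => {x.1, x.2} ⊆ S).card) :=
        Finset.sum_le_sum_of_subset (Finset.filter_subset _ _)
      _ = 2 * (U + V) := by rw [← Finset.mul_sum, Finset.sum_add_distrib]
  have hU' : 80 * U ≤ k * C := by
    refine Nat.le_of_mul_le_mul_left ?_ hn
    calc n * (80 * U) = 80 * n * U := by ring
      _ ≤ N * U := Nat.mul_le_mul_right _ hN
      _ ≤ n * (k * C) := hNU
  have hV' : 80 * V ≤ k * C := by
    have hpos : 0 < k * (N - 1) := Nat.mul_pos hk0 (by omega)
    refine Nat.le_of_mul_le_mul_left (Nat.le_of_mul_le_mul_left ?_ two_pos) hpos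
    calc 2 * (k * (N - 1) * (80 * V)) = 160 * k * ((N - 1) * V) := by ring
      _ ≤ n * ((N - 1) * V) := Nat.mul_le_mul_right _ hk
      _ = n * (N - 1) * V := by ring
      _ ≤ N * (k * k * C) := hNV'
      _ ≤ 2 * (N - 1) * (k * k * C) := Nat.mul_le_mul_right _ (by omega)
      _ = 2 * (k * (N - 1) * (k * C)) := by ring
  have : k * (20 * B.card) ≤ k * C := by nlinarith
  exact Nat.le_of_mul_le_mul_left this hk0

end PlantedClique

/-! ### The list of all item pairs -/

namespace OnlineLocal

/-- The pairs `i < j` of naturals below `n`, in the order of `j` and then of `i`. -/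
def natPairs (n : ℕ) : List (ℕ × ℕ) :=
  (List.range n).flatMap fun j => (List.range j).map fun i => (i, j)

theorem mem_natPairs {n : ℕ} {p : ℕ × ℕ} : p ∈ natPairs n ↔ p.1 < p.2 ∧ p.2 < n := by
  obtain ⟨i, j⟩ := p
  simp only [natPairs, List.mem_flatMap, List.mem_range, List.mem_map, Prod.mk.injEq]
  constructor
  · rintro ⟨j, hj, i, hi, rfl, rfl⟩
    exact ⟨hi, hj⟩
  · rintro ⟨hi, hj⟩
    exact ⟨j, hj, i, hi, rfl, rfl⟩

theorem nodup_natPairs (n : ℕ) : (natPairs n).Nodup := by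
  rw [natPairs, List.nodup_flatMap]
  constructor
  · intro j _
    exact List.nodup_range.map fun i i' h => (Prod.mk.inj h).1
  · refine List.nodup_range.imp fun {j j'} hne => ?_
    intro x hx hx'
    simp only [List.mem_map] at hx hx'
    obtain ⟨_, _, rfl⟩ := hx
    obtain ⟨_, _, h⟩ := hx'
    exact hne (Prod.mk.inj h).2.symm

/-- The pair of items with the given numbers. -/
def mkPair {n : ℕ} (p : ℕ × ℕ) (h : p.1 < p.2 ∧ p.2 < n) : ItemPair n :=
  ⟨(⟨p.1, h.1.trans h.2⟩, ⟨p.2, h.2⟩), fun e => h.1.ne (congrArg Fin.val e)⟩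

/-- All pairs `i < j` of items. -/
def allPairs (n : ℕ) : List (ItemPair n) :=
  (natPairs n).pmap mkPair fun _ => mem_natPairs.1

theorem length_allPairs (n : ℕ) : (allPairs n).length = ∑ j ∈ Finset.range n, j := by
  have : (List.range n).sum = ∑ j ∈ Finset.range n, j := by
    induction n with
    | zero => rfl
    | succ n ih => simp [List.range_succ, Finset.sum_range_succ, ih]
  simpa [allPairs, natPairs, List.length_flatMap] using this

theorem two_mul_length_allPairs_le (n : ℕ) : 2 * (allPairs n).length ≤ n * n := by
  rw [length_allPairs, mul_comm, Finset.sum_range_id_mul_two]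
  exact Nat.mul_le_mul_left n (Nat.sub_le n 1)

theorem mem_allPairs {n : ℕ} {i j : Fin n} (h : i < j) : ⟨(i, j), h.ne⟩ ∈ allPairs n := by
  rw [allPairs, List.mem_pmap]
  exact ⟨(i, j), mem_natPairs.2 ⟨h, j.2⟩, rfl⟩

theorem pairwise_allPairs (n : ℕ) :
    (allPairs n).Pairwise fun p q => s(p.1.1, p.1.2) ≠ s(q.1.1, q.1.2) := by
  rw [allPairs, List.pairwise_pmap]
  refine (nodup_natPairs n).imp fun {p q} hne hp hq h => hne ?_
  have h' := h
  simp only [mkPair, Sym2.eq_iff, Fin.mk.injEq] at h'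
  rcases h' with ⟨h1, h2⟩ | ⟨h1, h2⟩
  · exact Prod.ext h1 h2
  · omega

/-- The square of `X` is covered by the hit pairs, their reversals and the diagonal. -/
theorem card_sq_le_hitPairs {n L : ℕ} {H : Fin n → Fin L → Bool} {l : Fin n → Fin L}
    (X : Finset (Fin n)) (hX : ∀ i ∈ X, H i (l i) = true) :
    X.card * X.card ≤ 2 * hitPairs H l (allPairs n) + X.card := by
  classical
  set F : Finset (Fin n × Fin n) := (((allPairs n).filter fun p =>
    H p.1.1 (l p.1.1) && H p.1.2 (l p.1.2)).map Subtype.val).toFinset with hF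
  have hFc : F.card ≤ hitPairs H l (allPairs n) := by
    refine (List.toFinset_card_le _).trans ?_
    rw [List.length_map, hitPairs, List.countP_eq_length_filter]
  have hmem : ∀ {i j}, i ∈ X → j ∈ X → i < j → (i, j) ∈ F := by
    intro i j hi hj hij
    simp only [hF, List.mem_toFinset, List.mem_map, List.mem_filter]
    exact ⟨_, ⟨mem_allPairs hij, by simp [hX i hi, hX j hj]⟩, rfl⟩
  have hsub : X ×ˢ X ⊆ F ∪ F.image Prod.swap ∪ X.image fun i => (i, i) := by
    rintro ⟨i, j⟩ hij
    rw [Finset.mem_product] at hij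
    simp only [Finset.mem_union, Finset.mem_image]
    rcases lt_trichotomy i j with h | h | h
    · exact .inl (.inl (hmem hij.1 hij.2 h))
    · exact .inr ⟨i, hij.1, by rw [h]⟩
    · exact .inl (.inr ⟨(j, i), hmem hij.2 hij.1 h, rfl⟩)
  have h1 := Finset.card_le_card hsub
  have h2 := Finset.card_union_le (F ∪ F.image Prod.swap) (X.image fun i => (i, i))
  have h3 := Finset.card_union_le F (F.image Prod.swap)
  have h4 : (F.image Prod.swap).card ≤ F.card := Finset.card_image_le
  have h5 : (X.image fun i => (i, i)).card ≤ X.card := Finset.card_image_le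
  rw [Finset.card_product] at h1
  omega

end OnlineLocal

/-! ### Choice of the number of items -/

namespace PlantedClique

/-- The number of items in the reduction from graphs with `N` vertices, about `N ^ (a / b)`. -/
def items (a b N : ℕ) : ℕ := 2 ^ (a * Nat.clog (2 ^ b) (N + 1))

theorem items_pos (a b N : ℕ) : 0 < items a b N := by unfold items; positivity

theorem rpow_le_items {a b : ℕ} (hb : 0 < b) (N : ℕ) :
    (N : ℝ) ^ ((a : ℝ) / b) ≤ items a b N := by
  have h1 : (N : ℝ) ≤ (2 : ℝ) ^ (b * Nat.clog (2 ^ b) (N + 1)) := by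
    have := Nat.le_pow_clog (b := 2 ^ b) (Nat.one_lt_two_pow hb.ne') (N + 1)
    rw [← pow_mul] at this
    exact_mod_cast (Nat.le_succ N).trans this
  have hb' : (b : ℝ) ≠ 0 := by positivity
  calc (N : ℝ) ^ ((a : ℝ) / b) ≤ ((2 : ℝ) ^ (b * Nat.clog (2 ^ b) (N + 1))) ^ ((a : ℝ) / b) :=
        Real.rpow_le_rpow (by positivity) h1 (by positivity)
    _ = items a b N := by
        rw [items, ← Real.rpow_natCast, ← Real.rpow_mul (by norm_num)]
        push_cast
        rw [← Real.rpow_natCast]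
        congr 1
        push_cast
        field_simp

/-- The least `s` with `N + 1 ≤ (2 ^ b) ^ s` has `(2 ^ b) ^ (s - 1) ≤ N`. Rounding to such a power
costs only the constant `2 ^ a`, and makes the number of items computable by repeated doubling. -/
theorem items_le_rpow {a b : ℕ} (hb : 0 < b) {N : ℕ} (hN : 0 < N) :
    (items a b N : ℝ) ≤ 2 ^ a * (N : ℝ) ^ ((a : ℝ) / b) := by
  have h0 := Nat.pow_pred_clog_lt_self (b := 2 ^ b) (Nat.one_lt_two_pow hb.ne')
    (x := N + 1) (by omega)
  have hs : 0 < Nat.clog (2 ^ b) (N + 1) :=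
    Nat.clog_pos (Nat.one_lt_two_pow hb.ne') (by omega)
  obtain ⟨s, hs⟩ := Nat.exists_eq_succ_of_ne_zero hs.ne'
  rw [hs, Nat.pred_succ, ← pow_mul] at h0
  have h1 : (2 : ℝ) ^ (b * s) ≤ N := by exact_mod_cast Nat.lt_succ_iff.1 h0
  have hb' : (b : ℝ) ≠ 0 := by positivity
  calc (items a b N : ℝ) = 2 ^ a * ((2 : ℝ) ^ (b * s)) ^ ((a : ℝ) / b) := by
        rw [items, hs, ← Real.rpow_natCast 2 (b * s), ← Real.rpow_mul (by norm_num)]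
        push_cast
        rw [Nat.succ_eq_add_one, mul_add, mul_one, add_comm, pow_add, ← Real.rpow_natCast _ (a * s)]
        congr 2
        push_cast
        field_simp
    _ ≤ _ := by gcongr

theorem eventually_mul_rpow_le {s t : ℝ} (h : s < t) (K : ℝ) :
    ∀ᶠ N : ℕ in atTop, K * (N : ℝ) ^ s ≤ (N : ℝ) ^ t := by
  have h1 : Tendsto (fun N : ℕ => (N : ℝ) ^ (t - s)) atTop atTop :=
    (tendsto_rpow_atTop (sub_pos.2 h)).comp tendsto_natCast_atTop_atTop
  filter_upwards [h1.eventually_ge_atTop K, eventually_gt_atTop 0] with N hN hN0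
  have : (0 : ℝ) < N := Nat.cast_pos.2 hN0
  calc K * (N : ℝ) ^ s ≤ (N : ℝ) ^ (t - s) * (N : ℝ) ^ s := by gcongr
    _ = (N : ℝ) ^ t := by rw [← Real.rpow_add this, sub_add_cancel]

/-- The parameters of the reduction. -/
theorem exists_parameters {ε : ℝ} (h0 : 0 < ε) (h1 : ε ≤ 1) :
    ∃ a b : ℕ, 0 < b ∧ ∀ C : ℝ, 0 < C → ∀ᶠ N : ℕ in atTop,
      80 * items a b N ≤ N ∧ 160 * cliqueSize (ε / 6) N ≤ items a b N ∧
      ∀ h M : ℕ, cliqueSize (ε / 6) N ≤ 2 * h → h * h ≤ 2 * M + h →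
        20 * (C * Real.sqrt ((items a b N : ℝ) ^ 3 * ((N / items a b N : ℕ) : ℝ) ^ (1 - ε))) +
          3 * (2 * (items a b N : ℝ)) ≤ M := by
  -- The exponent `γ` of `n` must exceed that of `k` so that collisions are rare, and `γ < 1/2 -
  -- ε/12` is small enough for the regret to stay below `k²`. It is rational so that the
  -- distinguisher can compute `n`.
  obtain ⟨q, hq1, hq2⟩ := exists_rat_btwn (show 1 / 2 - ε / 6 < 1 / 2 - ε / 12 by linarith)
  have hq0 : (0 : ℝ) < q := by linarith
  have hnum : ((q.num.toNat : ℕ) : ℝ) / (q.den : ℝ) = q := by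
    have : 0 ≤ q.num := Rat.num_nonneg.2 (by exact_mod_cast hq0.le)
    conv_rhs => rw [← Rat.num_div_den q, Rat.cast_div, Rat.cast_intCast, Rat.cast_natCast]
    rw [← Int.cast_natCast, Int.toNat_of_nonneg this]
  refine ⟨q.num.toNat, q.den, q.den_pos, fun C hC => ?_⟩
  set a := q.num.toNat
  set γ : ℝ := (q : ℝ) with hγ
  set κ : ℝ := 1 / 2 - ε / 6 with hκ
  set e : ℝ := (γ * (2 + ε) + (1 - ε)) / 2 with he
  -- At `γ = 1/2 - ε/12` one has `2 * e = 2 - 2 * ε / 3 - ε² / 12`, just below `4 * κ = 2 - 2 * ε /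
  -- 3`.
  have he2 : e < 2 * κ := by rw [he, hκ]; nlinarith
  filter_upwards [eventually_mul_rpow_le (show γ < 1 by linarith) (80 * 2 ^ a),
    eventually_mul_rpow_le hq1 160,
    -- The `8` gives `h ≥ 2`, hence `h² ≤ 4 * M` and `N ^ (2 * κ) ≤ 64 * M` below. The two factors
    -- `128 = 2 * 64` then keep the regret term and the threshold term within `M / 2` each.
    eventually_mul_rpow_le (show 0 < κ by rw [hκ]; linarith) 8,
    eventually_mul_rpow_le he2 (128 * (20 * C * 2 ^ (3 * a))),
    eventually_mul_rpow_le (show γ < 2 * κ by linarith) (128 * (6 * 2 ^ a)),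
    eventually_gt_atTop 0] with N hA hB hD hE hF hN
  have hx : (0 : ℝ) < N := Nat.cast_pos.2 hN
  have hn1 := rpow_le_items (a := a) q.den_pos N
  have hn2 := items_le_rpow (a := a) q.den_pos hN
  rw [hnum] at hn1 hn2
  rw [Real.rpow_zero, mul_one] at hD
  rw [Real.rpow_one] at hA
  set n := items a q.den N with hn
  have hnpos : (0 : ℝ) < n := Nat.cast_pos.2 (items_pos _ _ _)
  have hcs : cliqueSize (ε / 6) N = ⌊(N : ℝ) ^ κ⌋₊ := rfl
  refine ⟨?_, ?_, ?_⟩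
  · have : (80 * n : ℝ) ≤ N := by nlinarith
    exact_mod_cast this
  · have hk : ((cliqueSize (ε / 6) N : ℕ) : ℝ) ≤ (N : ℝ) ^ κ := by
      rw [hcs]
      exact Nat.floor_le (by positivity)
    have : (160 * (cliqueSize (ε / 6) N : ℕ) : ℝ) ≤ n := by linarith
    exact_mod_cast this
  · intro h M hkh hM
    have hk : (N : ℝ) ^ κ < (cliqueSize (ε / 6) N : ℕ) + 1 := by
      rw [hcs]
      exact Nat.lt_floor_add_one _
    have hkh' : ((cliqueSize (ε / 6) N : ℕ) : ℝ) ≤ 2 * h := by exact_mod_cast hkh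
    have hM' : (h : ℝ) * h ≤ 2 * M + h := by exact_mod_cast hM
    have hh : (N : ℝ) ^ κ / 4 ≤ h := by linarith
    have hM2 : (N : ℝ) ^ (2 * κ) ≤ 64 * M := by
      rw [two_mul κ, Real.rpow_add hx]
      nlinarith
    have hL : (((N / n : ℕ) : ℝ)) ≤ N / n := Nat.cast_div_le
    -- With `L ≤ N / n` the radicand is at most `n ^ (2 + ε) * N ^ (1 - ε)`; here `ε ≤ 1` makes the
    -- power of `L` monotone.
    have hsq : (n : ℝ) ^ 3 * ((N / n : ℕ) : ℝ) ^ (1 - ε) ≤ (2 ^ (3 * a) * (N : ℝ) ^ e) ^ 2 := by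
      calc (n : ℝ) ^ 3 * ((N / n : ℕ) : ℝ) ^ (1 - ε)
          ≤ (n : ℝ) ^ 3 * ((N : ℝ) / n) ^ (1 - ε) := by
            gcongr
        _ = (n : ℝ) ^ (2 + ε) * (N : ℝ) ^ (1 - ε) := by
            rw [Real.div_rpow hx.le hnpos.le, show (2 + ε : ℝ) = (3 : ℕ) - (1 - ε) by push_cast; ring,
              Real.rpow_sub hnpos ((3 : ℕ) : ℝ) (1 - ε), Real.rpow_natCast]
            ring
        _ ≤ (2 ^ a * (N : ℝ) ^ γ) ^ (2 + ε) * (N : ℝ) ^ (1 - ε) := by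
            gcongr
        _ = ((2 : ℝ) ^ a) ^ (2 + ε) * (N : ℝ) ^ (2 * e) := by
            rw [Real.mul_rpow (by positivity) (by positivity), ← Real.rpow_mul hx.le, mul_assoc,
              ← Real.rpow_add hx, he]
            congr 2
            ring
        _ ≤ ((2 : ℝ) ^ a) ^ (6 : ℝ) * (N : ℝ) ^ (2 * e) := by
            gcongr
            · exact one_le_pow₀ (by norm_num)
            · linarith
        _ = _ := by
            rw [mul_pow, ← pow_mul, two_mul e, Real.rpow_add hx,
              show (6 : ℝ) = ((6 : ℕ) : ℝ) by norm_num, Real.rpow_natCast, ← pow_mul, sq ((N : ℝ) ^ e)]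
            congr 2
            ring
    have hroot : Real.sqrt ((n : ℝ) ^ 3 * ((N / n : ℕ) : ℝ) ^ (1 - ε)) ≤
        2 ^ (3 * a) * (N : ℝ) ^ e := Real.sqrt_le_iff.2 ⟨by positivity, hsq⟩
    have : C * Real.sqrt ((n : ℝ) ^ 3 * ((N / n : ℕ) : ℝ) ^ (1 - ε)) ≤
        C * (2 ^ (3 * a) * (N : ℝ) ^ e) := by gcongr
    linarith

end PlantedClique

/-! ### Deterministic program fragments -/

namespace RAM

/-- Sequential composition of a list of commands. -/
def seqs : List Cmd → Cmd
  | [] => .skip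
  | c :: l => .seq c (seqs l)

theorem reach_seqs_nil (K : List Cmd) (σ : Mem) : Reach 1 (seqs [] :: K, σ) (K, σ) := reach_skip K σ

theorem reach_seqs_cons (c : Cmd) (l : List Cmd) (K : List Cmd) (σ : Mem) :
    Reach 1 (seqs (c :: l) :: K, σ) (c :: seqs l :: K, σ) := reach_seq c (seqs l) K σ

theorem Reach.seqs_cons {t u : ℕ} {c : Cmd} {l : List Cmd} {K : List Cmd} {σ τ : Mem} {y : Cfg}
    (h : Reach t (c :: seqs l :: K, σ) (seqs l :: K, τ)) (h' : Reach u (seqs l :: K, τ) y) :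
    Reach (t + u + 1) (seqs (c :: l) :: K, σ) y :=
  ((reach_seqs_cons c l K σ).trans (h.trans h')).mono (by omega)

theorem Reach.to {s t : ℕ} {x : Cfg} {K : List Cmd} {σ τ : Mem} (h : Reach s x (K, σ)) (e : σ = τ)
    (hst : s ≤ t) : Reach t x (K, τ) := e ▸ h.mono hst

/-- A loop that runs `m` times through the memories `S 0`, …, `S m`. -/
theorem reach_loop_iterate {e : Expr} {c : Cmd} {t m : ℕ} (S : ℕ → Mem)
    (htest : ∀ u < m, e.eval (S u) ≠ 0)
    (hbody : ∀ u < m, ∀ K, Reach t (c :: K, S u) (K, S (u + 1))) (hend : e.eval (S m) = 0)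
    (K : List Cmd) : Reach (m * (t + 1) + 1) (.loop e c :: K, S 0) (K, S m) := by
  have : ∀ d u, u + d = m → Reach (d * (t + 1) + 1) (.loop e c :: K, S u) (K, S m) := by
    intro d
    induction d with
    | zero =>
      rintro u rfl
      simpa using reach_loop_false hend c K
    | succ d ih =>
      intro u hu
      exact ((reach_loop_true (htest u (by omega)) c K).trans
        ((hbody u (by omega) _).trans (ih (u + 1) (by omega)))).mono (by ring_nf; omega)
  exact this m 0 (Nat.zero_add m)

/-- The expression `2 ^ m * e`. -/
def Expr.shl (e : Expr) : ℕ → Expr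
  | 0 => e
  | m + 1 => .add (e.shl m) (e.shl m)

theorem Expr.eval_shl (e : Expr) (m : ℕ) (σ : Mem) : (e.shl m).eval σ = 2 ^ m * e.eval σ := by
  induction m with
  | zero => simp [Expr.shl]
  | succ m ih => rw [Expr.shl, Expr.eval, ih, pow_succ]; ring

end RAM

/-! ### Memory layout of the distinguisher and computation of `n` -/

namespace PlantedClique

open RAM OnlineLocal

/-- The variables of the distinguisher, and the memory of the simulated learner. -/
structure State where
  out : ℕ := 0
  pow : ℕ := 0
  num : ℕ := 0
  labels : ℕ := 0
  rounds : ℕ := 0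
  j : ℕ := 0
  i : ℕ := 0
  pos : ℕ := 0
  neg : ℕ := 0
  a : ℕ := 0
  b : ℕ := 0
  base : ℕ → ℕ := fun _ => 0
  learner : Mem := fun _ _ _ => 0

/-- The variables as a list. -/
def State.vars (s : State) : ℕ → ℕ
  | 0 => s.out
  | 1 => s.pow
  | 2 => s.num
  | 3 => s.labels
  | 4 => s.rounds
  | 5 => s.j
  | 6 => s.i
  | 7 => s.pos
  | 8 => s.neg
  | 9 => s.a
  | 10 => s.b
  | _ => 0

/-- The memory of the distinguisher: the graph in arrays `0` and `1`, the variables in array `2`,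
the table of label offsets in array `3`, followed by the arrays of the learner. -/
noncomputable def State.mem {N : ℕ} (G : SimpleGraph (Fin N)) (s : State) : Mem
  | 0 => graphMem G 0
  | 1 => graphMem G 1
  | 2 => fun x y => if x = 0 then s.vars y else 0
  | 3 => fun x y => if x = 0 then s.base y else 0
  | k + 4 => s.learner k

variable {N : ℕ} (G : SimpleGraph (Fin N))

theorem mem_default : State.mem G {} = graphMem G := by
  funext k x y
  match k with
  | 0 | 1 => rfl
  | 2 =>
    have : State.vars {} y = 0 := by
      unfold State.vars
      split <;> rfl
    simp [State.mem, graphMem, this]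
  | 3 => simp [State.mem, graphMem]
  | k + 4 => simp [State.mem, graphMem]

/-- The four arrays of the distinguisher are the frame for the shifted learner, so running the
learner changes only the field `learner`. -/
theorem join_mem (s : State) (σ : Mem) :
    Mem.join 4 (s.mem G) σ = State.mem G { s with learner := σ } := by
  funext k
  match k with
  | 0 | 1 | 2 | 3 => rfl
  | k + 4 => simp [Mem.join, State.mem]

theorem mem_set_base (s : State) (k v : ℕ) :
    (s.mem G).set 3 0 k v = State.mem G { s with base := Function.update s.base k v } := by
  funext c x y
  match c with
  | 0 | 1 | 2 => rfl
  | 3 =>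
    by_cases hx : x = 0 <;> by_cases hy : y = k <;> simp [Mem.set, State.mem, hx, hy]
  | c + 4 => simp [Mem.set, State.mem]

theorem mem_set_learner (s : State) (c k l v : ℕ) :
    (s.mem G).set (c + 4) k l v = State.mem G { s with learner := s.learner.set c k l v } := by
  funext d x y
  match d with
  | 0 | 1 | 2 | 3 => simp [Mem.set, State.mem, State.vars]
  | d + 4 => simp [Mem.set, State.mem]

/-- The expression that reads a variable. -/
def var (k : ℕ) : Expr := .read 2 (.const 0) (.const k)

/-- The command that writes a variable. -/
def put (k : ℕ) (e : Expr) : Cmd := .assign 2 (.const 0) (.const k) e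

theorem eval_var (s : State) (k : ℕ) : (var k).eval (s.mem G) = s.vars k := rfl

theorem reach_put {s s' : State} {k : ℕ} (e : Expr) (K : List Cmd)
    (h : ∀ l, l ≠ k → s'.vars l = s.vars l) (hk : s'.vars k = e.eval (s.mem G))
    (hb : s'.base = s.base) (hl : s'.learner = s.learner) :
    Reach 1 (put k e :: K, s.mem G) (K, s'.mem G) := by
  have : s'.mem G = (s.mem G).set 2 0 k (e.eval (s.mem G)) := by
    funext c x y
    match c with
    | 0 | 1 => rfl
    | 2 =>
      by_cases hx : x = 0 <;> by_cases hy : y = k <;> simp [Mem.set, State.mem, hx, hy, h, hk]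
    | 3 => simp [Mem.set, State.mem, hb]
    | c + 4 => simp [Mem.set, State.mem, hl]
  rw [this]
  exact reach_assign 2 (.const 0) (.const k) e K (s.mem G)

theorem reach_put_out (s : State) (e : Expr) (K : List Cmd) :
    Reach 1 (put 0 e :: K, s.mem G) (K, State.mem G { s with out := e.eval (s.mem G) }) :=
  reach_put G e K (fun l hl => by unfold State.vars; split <;> simp_all) rfl rfl rfl

theorem reach_put_pow (s : State) (e : Expr) (K : List Cmd) :
    Reach 1 (put 1 e :: K, s.mem G) (K, State.mem G { s with pow := e.eval (s.mem G) }) :=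
  reach_put G e K (fun l hl => by unfold State.vars; split <;> simp_all) rfl rfl rfl

theorem reach_put_num (s : State) (e : Expr) (K : List Cmd) :
    Reach 1 (put 2 e :: K, s.mem G) (K, State.mem G { s with num := e.eval (s.mem G) }) :=
  reach_put G e K (fun l hl => by unfold State.vars; split <;> simp_all) rfl rfl rfl

theorem reach_put_labels (s : State) (e : Expr) (K : List Cmd) :
    Reach 1 (put 3 e :: K, s.mem G) (K, State.mem G { s with labels := e.eval (s.mem G) }) :=
  reach_put G e K (fun l hl => by unfold State.vars; split <;> simp_all) rfl rfl rfl

theorem reach_put_rounds (s : State) (e : Expr) (K : List Cmd) :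
    Reach 1 (put 4 e :: K, s.mem G) (K, State.mem G { s with rounds := e.eval (s.mem G) }) :=
  reach_put G e K (fun l hl => by unfold State.vars; split <;> simp_all) rfl rfl rfl

theorem reach_put_j (s : State) (e : Expr) (K : List Cmd) :
    Reach 1 (put 5 e :: K, s.mem G) (K, State.mem G { s with j := e.eval (s.mem G) }) :=
  reach_put G e K (fun l hl => by unfold State.vars; split <;> simp_all) rfl rfl rfl

theorem reach_put_i (s : State) (e : Expr) (K : List Cmd) :
    Reach 1 (put 6 e :: K, s.mem G) (K, State.mem G { s with i := e.eval (s.mem G) }) :=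
  reach_put G e K (fun l hl => by unfold State.vars; split <;> simp_all) rfl rfl rfl

theorem reach_put_pos (s : State) (e : Expr) (K : List Cmd) :
    Reach 1 (put 7 e :: K, s.mem G) (K, State.mem G { s with pos := e.eval (s.mem G) }) :=
  reach_put G e K (fun l hl => by unfold State.vars; split <;> simp_all) rfl rfl rfl

theorem reach_put_neg (s : State) (e : Expr) (K : List Cmd) :
    Reach 1 (put 8 e :: K, s.mem G) (K, State.mem G { s with neg := e.eval (s.mem G) }) :=
  reach_put G e K (fun l hl => by unfold State.vars; split <;> simp_all) rfl rfl rfl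

theorem reach_put_a (s : State) (e : Expr) (K : List Cmd) :
    Reach 1 (put 9 e :: K, s.mem G) (K, State.mem G { s with a := e.eval (s.mem G) }) :=
  reach_put G e K (fun l hl => by unfold State.vars; split <;> simp_all) rfl rfl rfl

theorem reach_put_b (s : State) (e : Expr) (K : List Cmd) :
    Reach 1 (put 10 e :: K, s.mem G) (K, State.mem G { s with b := e.eval (s.mem G) }) :=
  reach_put G e K (fun l hl => by unfold State.vars; split <;> simp_all) rfl rfl rfl

theorem reach_set_base (s : State) (x e : Expr) (K : List Cmd) :
    Reach 1 (.assign 3 (.const 0) x e :: K, s.mem G)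
      (K, State.mem G { s with
        base := Function.update s.base (x.eval (s.mem G)) (e.eval (s.mem G)) }) := by
  rw [← mem_set_base]
  exact reach_assign 3 (.const 0) x e K (s.mem G)

theorem reach_set_learner (s : State) (c : ℕ) (x y e : Expr) (K : List Cmd) :
    Reach 1 (.assign (c + 4) x y e :: K, s.mem G)
      (K, State.mem G { s with
        learner := s.learner.set c (x.eval (s.mem G)) (y.eval (s.mem G)) (e.eval (s.mem G)) }) := by
  rw [← mem_set_learner]
  exact reach_assign (c + 4) x y e K (s.mem G)

/-- The expression that reads the number of vertices. -/
def vertexCount : Expr := .read 0 (.const 0) (.const 0)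

theorem eval_vertexCount (s : State) : vertexCount.eval (s.mem G) = N := by
  simp [vertexCount, Expr.eval, State.mem, graphMem]

/-- Computes the number of items. -/
def itemsCmd (a b : ℕ) : Cmd := seqs [put 1 (.const 1), put 2 (.const 1),
  .loop (.sub (.add vertexCount (.const 1)) (var 1))
    (seqs [put 1 ((var 1).shl b), put 2 ((var 2).shl a)])]

theorem reach_itemsCmd {a b : ℕ} (hb : 0 < b) (K : List Cmd) :
    Reach (10 * N + 20) (itemsCmd a b :: K, State.mem G {})
      (K, State.mem G { pow := (2 ^ b) ^ Nat.clog (2 ^ b) (N + 1), num := items a b N }) := by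
  have hb1 : 1 < 2 ^ b := Nat.one_lt_two_pow hb.ne'
  set m := Nat.clog (2 ^ b) (N + 1) with hm
  -- The number of doublings is logarithmic, but a linear bound is enough for polynomial time.
  have hmN : m ≤ N + 1 := Nat.clog_le_of_le_pow (Nat.lt_pow_self hb1).le
  have hloop := reach_loop_iterate (e := .sub (.add vertexCount (.const 1)) (var 1))
    (c := seqs [put 1 ((var 1).shl b), put 2 ((var 2).shl a)]) (t := 5) (m := m)
    (fun u => State.mem G { pow := (2 ^ b) ^ u, num := (2 ^ a) ^ u })
    (by
      intro u hu
      have : (2 ^ b) ^ u < N + 1 := (Nat.lt_clog_iff_pow_lt hb1).1 hu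
      simp only [Expr.eval, eval_vertexCount, eval_var, State.vars]
      omega)
    (by
      intro u hu K
      refine Reach.to (Reach.seqs_cons (reach_put_pow G _ _ _) (Reach.seqs_cons
        (reach_put_num G _ _ _) (reach_seqs_nil _ _))) ?_ le_rfl
      simp [Expr.eval_shl, eval_var, State.vars, pow_succ, mul_comm])
    (by
      have : N + 1 ≤ (2 ^ b) ^ m := Nat.le_pow_clog hb1 _
      simp only [Expr.eval, eval_vertexCount, eval_var, State.vars]
      omega)
  simp only [pow_zero] at hloop
  refine Reach.to (Reach.seqs_cons (reach_put_pow G _ _ _) (Reach.seqs_cons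
    (reach_put_num G _ _ _) (Reach.seqs_cons (hloop _) (reach_seqs_nil _ _)))) ?_ (by omega)
  simp [items, pow_mul, hm]

end PlantedClique

/-! ### Label offsets, learner's input, and writing the payoffs -/

namespace PlantedClique

open RAM OnlineLocal

variable {N : ℕ} (G : SimpleGraph (Fin N))

/-- Computes the number of labels and the table of label offsets. -/
def gridCmd : Cmd :=
  .loop (.sub (.add vertexCount (.const 1)) (.add (.read 3 (.const 0) (var 3)) (var 2)))
    (seqs [.assign 3 (.const 0) (.add (var 3) (.const 1))
      (.add (.read 3 (.const 0) (var 3)) (var 2)), put 3 (.add (var 3) (.const 1))])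

/-- The state once the numbers of items and labels have been computed. -/
def gridState (P n L : ℕ) : State where
  pow := P
  num := n
  labels := L
  base := fun x => if x ≤ L then n * x else 0

theorem mem_base (s : State) (x : ℕ) : s.mem G 3 0 x = s.base x := rfl

/-- Division by repeated addition: the test is nonzero exactly while `n * (u + 1) ≤ N`, so the loop
stops at `u = N / n`. The multiples of `n` are tabulated on the way, as the machine cannot multiply.
-/
theorem reach_gridCmd {P n : ℕ} (hn : 0 < n) (K : List Cmd) :
    Reach (6 * N + 1) (gridCmd :: K, State.mem G { pow := P, num := n })
      (K, (gridState P n (N / n)).mem G) := by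
  have h := reach_loop_iterate
    (e := .sub (.add vertexCount (.const 1)) (.add (.read 3 (.const 0) (var 3)) (var 2)))
    (c := seqs [.assign 3 (.const 0) (.add (var 3) (.const 1))
      (.add (.read 3 (.const 0) (var 3)) (var 2)), put 3 (.add (var 3) (.const 1))])
    (t := 5) (m := N / n) (fun u => (gridState P n u).mem G)
    (by
      intro u hu
      have : n * (u + 1) ≤ n * (N / n) := Nat.mul_le_mul_left n hu
      have := Nat.mul_div_le N n
      simp only [Expr.eval, eval_vertexCount, eval_var, mem_base, State.vars, gridState, le_refl,
        if_true]
      rw [Nat.mul_add] at *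
      omega)
    (by
      intro u hu K
      refine Reach.to (Reach.seqs_cons (reach_set_base G _ _ _ _) (Reach.seqs_cons
        (reach_put_labels G _ _ _) (reach_seqs_nil _ _))) ?_ le_rfl
      congr 1
      simp only [Expr.eval, eval_var, State.vars, gridState, mem_base, le_refl, if_true,
        State.mk.injEq, true_and, and_true]
      funext x
      by_cases hx : x = u + 1
      · subst hx
        simp [Nat.mul_add]
      · have : x ≤ u ↔ x ≤ u + 1 := by omega
        simp [hx, this])
    (by
      have := Nat.lt_mul_div_succ N hn
      simp only [Expr.eval, eval_vertexCount, eval_var, mem_base, State.vars, gridState, le_refl,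
        if_true]
      rw [Nat.mul_add] at *
      omega) K
  have h0 : gridState P n 0 = { pow := P, num := n } := by
    simp only [gridState, State.mk.injEq, true_and, and_true]
    funext x
    by_cases hx : x = 0 <;> simp [hx]
  rw [h0] at h
  exact h.mono (by have := Nat.div_le_self N n; omega)

/-- Computes the number of rounds. -/
def countCmd : Cmd := seqs [.loop (.sub (var 2) (var 5))
  (seqs [put 4 (.add (var 4) (var 5)), put 5 (.add (var 5) (.const 1))]), put 5 (.const 0)]

theorem reach_countCmd {s : State} (hr : s.rounds = 0) (hj : s.j = 0) (K : List Cmd) :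
    Reach (6 * s.num + 5) (countCmd :: K, s.mem G)
      (K, State.mem G { s with rounds := ∑ j ∈ Finset.range s.num, j }) := by
  have h := reach_loop_iterate (e := .sub (var 2) (var 5))
    (c := seqs [put 4 (.add (var 4) (var 5)), put 5 (.add (var 5) (.const 1))])
    (t := 5) (m := s.num)
    (fun u => State.mem G { s with rounds := ∑ j ∈ Finset.range u, j, j := u })
    (by
      intro u hu
      simp only [Expr.eval, eval_var, State.vars]
      omega)
    (by
      intro u hu K
      refine Reach.to (Reach.seqs_cons (reach_put_rounds G _ _ _) (Reach.seqs_cons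
        (reach_put_j G _ _ _) (reach_seqs_nil _ _))) ?_ le_rfl
      simp [Expr.eval, eval_var, State.vars, Finset.sum_range_succ])
    (by simp [Expr.eval, eval_var, State.vars])
  have h0 : ({ s with rounds := ∑ j ∈ Finset.range 0, j, j := 0 } : State) = s := by
    cases s
    simp_all
  rw [h0] at h
  refine Reach.to (Reach.seqs_cons (h _) (Reach.seqs_cons (reach_put_j G _ _ _)
    (reach_seqs_nil _ _))) ?_ (by omega)
  simp [Expr.eval, hj]

/-- Writes the initial memory of the learner. -/
def startCmd : Cmd := seqs [.assign (0 + 4) (.const 0) (.const 0) (var 2),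
  .assign (0 + 4) (.const 0) (.const 1) (var 3), .assign (0 + 4) (.const 0) (.const 2) (var 4)]

theorem reach_startCmd {s : State} (hl : s.learner = fun _ _ _ => 0) (K : List Cmd) :
    Reach 7 (startCmd :: K, s.mem G)
      (K, State.mem G { s with learner := startMem s.num s.labels s.rounds }) := by
  refine Reach.to (Reach.seqs_cons (reach_set_learner G _ _ _ _ _ _)
    (Reach.seqs_cons (reach_set_learner G _ _ _ _ _ _)
    (Reach.seqs_cons (reach_set_learner G _ _ _ _ _ _) (reach_seqs_nil _ _)))) ?_ le_rfl
  simp only [Expr.eval, eval_var, State.vars, hl]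
  rfl

/-- The state in which the simulation of the rounds is going on. -/
structure Ready (n L : ℕ) (s : State) : Prop where
  num : s.num = n
  labels : s.labels = L
  base : ∀ x < L, s.base x = n * x
  a : s.a = 0
  b : s.b = 0

/-- The adjacency of the vertices given by two labels of the current pair of items. -/
def edge (e f : Expr) : Expr :=
  .read 1 (.add (.read 3 (.const 0) e) (var 6)) (.add (.read 3 (.const 0) f) (var 5))

variable {G} {n L : ℕ}

/-- With the offsets tabulated, adding `i` to `n * a` yields the number of the vertex `vertex hNL i
a`, so the adjacency matrix is read at the block entry. -/
theorem eval_edge (hNL : n * L ≤ N) {s : State} (hb : ∀ x < L, s.base x = n * x)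
    (h : s.i < s.j ∧ s.j < n) {e f : Expr} {a b : ℕ} (he : e.eval (s.mem G) = a)
    (hf : f.eval (s.mem G) = b) (ha : a < L) (hbL : b < L) :
    (edge e f).eval (s.mem G) =
      if block (vertex hNL) G (mkPair (s.i, s.j) h) ⟨a, ha⟩ ⟨b, hbL⟩ then 1 else 0 := by
  have h1 : (edge e f).eval (s.mem G) = graphMem G 1 (n * a + s.i) (n * b + s.j) := by
    rw [← hb a ha, ← hb b hbL, ← he, ← hf]
    rfl
  rw [h1]
  simp only [graphMem, one_ne_zero, if_false, if_true]
  by_cases hw : block (vertex hNL) G (mkPair (s.i, s.j) h) ⟨a, ha⟩ ⟨b, hbL⟩ = true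
  · rw [if_pos hw, if_pos ⟨_, _, (block_eq_true _ _ _ _).1 hw, rfl, rfl⟩]
  · rw [if_neg hw, if_neg]
    rintro ⟨u, v, hadj, hu, hv⟩
    refine hw ((block_eq_true _ _ _ _).2 ?_)
    convert hadj
    · exact Fin.ext hu.symm
    · exact Fin.ext hv.symm

/-- The payoffs are written to the memory for the entries before `(a, b)`. -/
def revealUpto (r : Round n L) (a b : ℕ) (σ : Mem) : Mem := fun k x y =>
  if x < a ∨ (x = a ∧ y < b) then r.reveal σ k x y else σ k x y

theorem revealUpto_zero (r : Round n L) (σ : Mem) : revealUpto r 0 0 σ = σ := by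
  funext k x y
  simp [revealUpto]

theorem revealUpto_row (r : Round n L) (a : ℕ) (σ : Mem) :
    revealUpto r a L σ = revealUpto r (a + 1) 0 σ := by
  funext k x y
  by_cases hx : x = a
  · subst hx
    by_cases hy : y < L <;> simp [revealUpto, Round.reveal, hy]
  · have : x < a ↔ x < a + 1 := by omega
    simp [revealUpto, hx, this]

theorem revealUpto_all (r : Round n L) (σ : Mem) : revealUpto r L 0 σ = r.reveal σ := by
  funext k x y
  by_cases hx : x < L <;> simp [revealUpto, Round.reveal, hx]

/-- A payoff `±1` has numerator of absolute value 1 and denominator 1; its sign bit is the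
complement of adjacency. -/
theorem revealUpto_succ (p : ItemPair n) (w : Fin L → Fin L → Bool) {a b : ℕ} (ha : a < L)
    (hb : b < L) (σ : Mem) :
    revealUpto (signRound p w) a (b + 1) σ =
      (((revealUpto (signRound p w) a b σ).set 3 a b 1).set 4 a b
        (1 - if w ⟨a, ha⟩ ⟨b, hb⟩ then 1 else 0)).set 5 a b 1 := by
  funext k x y
  by_cases hxy : x = a ∧ y = b
  · obtain ⟨rfl, rfl⟩ := hxy
    by_cases h3 : k = 3
    · subst h3
      simp only [revealUpto, Round.reveal, signRound, Mem.set]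
      cases hw : w ⟨x, ha⟩ ⟨y, hb⟩ <;> simp [ha, hb, hw]
    by_cases h4 : k = 4
    · subst h4
      simp only [revealUpto, Round.reveal, signRound, Mem.set]
      cases hw : w ⟨x, ha⟩ ⟨y, hb⟩ <;> simp [ha, hb, hw]
    by_cases h5 : k = 5
    · subst h5
      simp only [revealUpto, Round.reveal, signRound, Mem.set]
      cases hw : w ⟨x, ha⟩ ⟨y, hb⟩ <;> simp [ha, hb, hw]
    simp [revealUpto, Round.reveal, Mem.set, h3, h4, h5]
  · have h1 : (x < a ∨ x = a ∧ y < b + 1) ↔ (x < a ∨ x = a ∧ y < b) := by omega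
    simp only [revealUpto, Mem.set, hxy, h1, and_false, if_false]

/-- Writes one entry of the payoff function. -/
def cellCmd : Cmd := seqs [.assign (3 + 4) (var 9) (var 10) (.const 1),
  .assign (4 + 4) (var 9) (var 10) (.sub (.const 1) (edge (var 9) (var 10))),
  .assign (5 + 4) (var 9) (var 10) (.const 1), put 10 (.add (var 10) (.const 1))]

/-- Writes one row of the payoff function. -/
def rowCmd : Cmd := seqs [.loop (.sub (var 3) (var 10)) cellCmd, put 10 (.const 0),
  put 9 (.add (var 9) (.const 1))]

/-- Writes the payoff function. -/
def revealCmd : Cmd := seqs [.loop (.sub (var 3) (var 9)) rowCmd, put 9 (.const 0)]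

theorem reach_rowCmd (hNL : n * L ≤ N) {s : State} (hs : s.labels = L)
    (hbase : ∀ x < L, s.base x = n * x) (hb : s.b = 0) (h : s.i < s.j ∧ s.j < n) (σ : Mem)
    (ha : s.a < L)
    (hσ : s.learner =
      revealUpto (signRound (mkPair (s.i, s.j) h) (block (vertex hNL) G (mkPair (s.i, s.j) h)))
        s.a 0 σ) (K : List Cmd) :
    Reach (10 * L + 7) (rowCmd :: K, s.mem G) (K, State.mem G { s with
      a := s.a + 1
      learner := revealUpto
        (signRound (mkPair (s.i, s.j) h) (block (vertex hNL) G (mkPair (s.i, s.j) h)))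
        (s.a + 1) 0 σ }) := by
  set r := signRound (mkPair (s.i, s.j) h) (block (vertex hNL) G (mkPair (s.i, s.j) h)) with hr
  have hloop := reach_loop_iterate (e := .sub (var 3) (var 10)) (c := cellCmd) (t := 9) (m := L)
    (fun u => State.mem G { s with b := u, learner := revealUpto r s.a u σ })
    (by
      intro u hu
      simp only [Expr.eval, eval_var, State.vars]
      omega)
    (by
      intro u hu K
      refine Reach.to (Reach.seqs_cons (reach_set_learner G _ _ _ _ _ _)
        (Reach.seqs_cons (reach_set_learner G _ _ _ _ _ _)
        (Reach.seqs_cons (reach_set_learner G _ _ _ _ _ _)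
        (Reach.seqs_cons (reach_put_b G _ _ _) (reach_seqs_nil _ _))))) ?_ le_rfl
      congr 1
      rw [hr, revealUpto_succ _ _ ha hu, ← hr]
      simp only [Expr.eval]
      rw [eval_edge hNL (s := { s with b := u, learner := _ }) hbase h (a := s.a) (b := u) rfl rfl
        ha hu]
      simp only [eval_var, State.vars])
    (by simp [Expr.eval, eval_var, State.vars, hs])
  have h0 : ({ s with b := 0, learner := revealUpto r s.a 0 σ } : State) = s := by
    rw [← hσ, ← hb]
  rw [h0] at hloop
  refine Reach.to (Reach.seqs_cons (hloop _) (Reach.seqs_cons (reach_put_b G _ _ _)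
    (Reach.seqs_cons (reach_put_a G _ _ _) (reach_seqs_nil _ _)))) ?_ (by omega)
  simp [Expr.eval, eval_var, State.vars, revealUpto_row, hb]

theorem reach_revealCmd (hNL : n * L ≤ N) {s : State} (hs : Ready n L s)
    (h : s.i < s.j ∧ s.j < n) (K : List Cmd) :
    Reach (10 * L * L + 8 * L + 5) (revealCmd :: K, s.mem G) (K, State.mem G { s with
      learner := (signRound (mkPair (s.i, s.j) h)
        (block (vertex hNL) G (mkPair (s.i, s.j) h))).reveal s.learner }) := by
  set r := signRound (mkPair (s.i, s.j) h) (block (vertex hNL) G (mkPair (s.i, s.j) h)) with hr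
  have hloop := reach_loop_iterate (e := .sub (var 3) (var 9)) (c := rowCmd) (t := 10 * L + 7)
    (m := L)
    (fun u => State.mem G { s with a := u, learner := revealUpto r u 0 s.learner })
    (by
      intro u hu
      simp only [Expr.eval, eval_var, State.vars, hs.labels]
      omega)
    (by
      intro u hu K
      exact reach_rowCmd hNL (s := { s with a := u, learner := revealUpto r u 0 s.learner })
        hs.labels hs.base hs.b h s.learner hu rfl K)
    (by simp [Expr.eval, eval_var, State.vars, hs.labels])
  have h0 : ({ s with a := 0, learner := revealUpto r 0 0 s.learner } : State) = s := by
    rw [revealUpto_zero, ← hs.a]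
  rw [h0] at hloop
  refine Reach.to (Reach.seqs_cons (hloop _) (Reach.seqs_cons (reach_put_a G _ _ _)
    (reach_seqs_nil _ _))) ?_ (by ring_nf; omega)
  simp [Expr.eval, revealUpto_all, hs.a]

end PlantedClique

/-! ### Simulation of the learner and law of the verdict -/

namespace PlantedClique

open RAM OnlineLocal

variable {N : ℕ} {G : SimpleGraph (Fin N)} {n L : ℕ}

/-- The bit that the distinguisher finally reads off. -/
def verdict (σ : Mem) : Bool := decide (σ 2 0 0 ≠ 0)

/-- The distribution of the verdict when the rounds `rs` remain to be played from the state `s`. -/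
noncomputable def outcome (A : Learner) (t n : ℕ) (s : State) (rs : List (Round n L)) : PMF Bool :=
  (A.play t rs s.learner).map fun x => decide ((2 * n : ℚ) ≤ s.pos - s.neg + x)

theorem outcome_cons (A : Learner) (t : ℕ) (s : State) (r : Round n L) (rs : List (Round n L)) :
    outcome A t n s (r :: rs) = (exec t A.predict (r.ask s.learner)).bind fun τ =>
      (exec t A.update (r.reveal τ)).bind fun υ => (A.play t rs υ).map fun x =>
        decide ((2 * n : ℚ) ≤ s.pos - s.neg + (r.reward (label₁ τ) (label₂ τ) + x)) := by
  simp only [outcome, Learner.play, PMF.map_bind, PMF.map_comp]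
  rfl

/-- The label of the first item in the learner's answer. -/
def firstLabel : Expr := .read (2 + 4) (.const 0) (.const 0)

/-- The label of the second item in the learner's answer. -/
def secondLabel : Expr := .read (2 + 4) (.const 0) (.const 1)

/-- Counts the payoff of the current round. -/
def scoreCmd : Cmd := .ite (edge firstLabel secondLabel) (put 7 (.add (var 7) (.const 1)))
  (put 8 (.add (var 8) (.const 1)))

/-- Plays one round with the learner `A`. -/
def roundCmd (A : Learner) : Cmd := seqs [.assign (1 + 4) (.const 0) (.const 0) (var 6),
  .assign (1 + 4) (.const 0) (.const 1) (var 5), A.predict.shift 4, scoreCmd, revealCmd,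
  A.update.shift 4, put 6 (.add (var 6) (.const 1))]

/-- Cells hold naturals, so the signed score is kept as a difference of two counters. -/
theorem exists_reach_scoreCmd (hNL : n * L ≤ N) {s : State} (hs : Ready n L s)
    (h : s.i < s.j ∧ s.j < n) (h₁ : label₁ s.learner < L) (h₂ : label₂ s.learner < L) :
    ∃ pos neg : ℕ, (pos : ℚ) - neg = s.pos - s.neg +
        (signRound (mkPair (s.i, s.j) h) (block (vertex hNL) G (mkPair (s.i, s.j) h))).reward
          (label₁ s.learner) (label₂ s.learner) ∧
      ∀ K, Reach 2 (scoreCmd :: K, s.mem G)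
        (K, State.mem G { s with pos := pos, neg := neg }) := by
  have he := eval_edge (G := G) hNL hs.base h (e := firstLabel) (f := secondLabel)
    (a := label₁ s.learner) (b := label₂ s.learner) rfl rfl h₁ h₂
  by_cases hw : block (vertex hNL) G (mkPair (s.i, s.j) h) ⟨_, h₁⟩ ⟨_, h₂⟩ = true
  · refine ⟨s.pos + 1, s.neg, ?_, fun K => ?_⟩
    · simp only [Round.reward, dif_pos (And.intro h₁ h₂), signRound, if_pos hw]
      push_cast
      ring
    · rw [if_pos hw] at he
      exact (reach_ite_true (by rw [he]; exact one_ne_zero) _ _ _).trans (reach_put_pos G s _ K)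
  · refine ⟨s.pos, s.neg + 1, ?_, fun K => ?_⟩
    · simp only [Round.reward, dif_pos (And.intro h₁ h₂), signRound, if_neg hw]
      push_cast
      ring
    · rw [if_neg hw] at he
      exact (reach_ite_false he _ _ _).trans (reach_put_neg G s _ K)

theorem Yields.seqs_cons {t : ℕ} {c : Cmd} {l : List Cmd} {K : List Cmd} {σ : Mem} {α : Type*}
    {g : Mem → α} {ν : PMF α} (h : Yields g t (c :: seqs l :: K, σ) ν) :
    Yields g (1 + t) (seqs (c :: l) :: K, σ) ν := (reach_seqs_cons c l K σ).yields h

/-- An upper bound for the number of steps that a round takes in addition to the learner's. -/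
def overhead (L : ℕ) : ℕ := 10 * L * L + 8 * L + 20

/-- Both activations of the learner go through `yields_shift`; everything between them is
deterministic. The rest of the run enters as the continuation `hK`, because the state after the
round depends on the coins. -/
theorem yields_roundCmd (hNL : n * L ≤ N) {A : Learner} {t t' : ℕ} {s : State}
    (hs : Ready n L s) (h : s.i < s.j ∧ s.j < n) {rs : List (Round n L)} {K : List Cmd}
    (hruns : A.Runs t (signRound (mkPair (s.i, s.j) h)
      (block (vertex hNL) G (mkPair (s.i, s.j) h)) :: rs) s.learner)
    (hK : ∀ s', Ready n L s' → s'.i = s.i + 1 → s'.j = s.j → A.Runs t rs s'.learner →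
      Yields verdict t' (K, s'.mem G) (outcome A t n s' rs)) :
    Yields verdict (2 * t + overhead L + t') (roundCmd A :: K, s.mem G)
      (outcome A t n s (signRound (mkPair (s.i, s.j) h)
        (block (vertex hNL) G (mkPair (s.i, s.j) h)) :: rs)) := by
  set r := signRound (mkPair (s.i, s.j) h) (block (vertex hNL) G (mkPair (s.i, s.j) h)) with hr
  obtain ⟨hp, hrest⟩ := hruns
  rw [outcome_cons]
  have hupd : ∀ τ ∈ (exec t A.predict (r.ask s.learner)).support,
      Yields verdict (10 * L * L + 8 * L + 14 + t + t')
        (seqs [scoreCmd, revealCmd, A.update.shift 4, put 6 (.add (var 6) (.const 1))] :: K,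
          Mem.join 4 (s.mem G) τ)
        ((exec t A.update (r.reveal τ)).bind fun υ => (A.play t rs υ).map fun x =>
          decide ((2 * n : ℚ) ≤ s.pos - s.neg + (r.reward (label₁ τ) (label₂ τ) + x))) := by
    intro τ hτ
    obtain ⟨h₁, h₂, hu, hrest'⟩ := hrest τ hτ
    obtain ⟨pos, neg, hscore, hreach⟩ := exists_reach_scoreCmd (G := G) hNL
      (s := { s with learner := τ }) ⟨hs.num, hs.labels, hs.base, hs.a, hs.b⟩ h h₁ h₂
    rw [join_mem]
    have hrev := reach_revealCmd (G := G) hNL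
      (s := { s with learner := τ, pos := pos, neg := neg })
      ⟨hs.num, hs.labels, hs.base, hs.a, hs.b⟩ h
    have hfin : ∀ υ ∈ (exec t A.update (r.reveal τ)).support, Yields verdict (3 + t')
        (seqs [put 6 (.add (var 6) (.const 1))] :: K,
          Mem.join 4 (State.mem G { s with learner := τ, pos := pos, neg := neg }) υ)
        ((A.play t rs υ).map fun x =>
          decide ((2 * n : ℚ) ≤ s.pos - s.neg + (r.reward (label₁ τ) (label₂ τ) + x))) := by
      intro υ hυ
      rw [join_mem]
      have hput := Reach.seqs_cons (reach_put_i G { s with learner := υ, pos := pos, neg := neg }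
        (.add (var 6) (.const 1)) _) (reach_seqs_nil K _)
      have := hK { s with learner := υ, pos := pos, neg := neg, i := s.i + 1 }
        ⟨hs.num, hs.labels, hs.base, hs.a, hs.b⟩ rfl rfl (hrest' υ hυ)
      convert hput.yields this using 1
      rw [outcome]
      congr 1
      funext x
      rw [hscore]
      simp only [add_assoc]
      rfl
    have hshift := yields_shift 4 (State.mem G { s with learner := τ, pos := pos, neg := neg }) hu
      hfin
    rw [join_mem] at hshift
    have hall := (Reach.seqs_cons (hreach _) (Reach.seqs_cons (hrev _)
      (reach_seqs_cons _ _ K _))).yields hshift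
    exact hall.mono (by omega)
  have hshift := yields_shift 4 (s.mem G) hp hupd
  rw [join_mem] at hshift
  have hask := Reach.seqs_cons (reach_set_learner G s 1 (.const 0) (.const 0) (var 6) _)
    (Reach.seqs_cons (reach_set_learner G _ 1 (.const 0) (.const 1) (var 5) _)
      (reach_seqs_cons (A.predict.shift 4) [scoreCmd, revealCmd, A.update.shift 4,
        put 6 (.add (var 6) (.const 1))] K _))
  exact (hask.yields hshift).mono (by unfold overhead; omega)

/-- The rounds for a list of pairs of naturals. -/
noncomputable def natRounds (hNL : n * L ≤ N) (G : SimpleGraph (Fin N)) (ps : List (ℕ × ℕ))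
    (h : ∀ p ∈ ps, p.1 < p.2 ∧ p.2 < n) : List (Round n L) :=
  graphRounds (vertex hNL) G (ps.pmap mkPair h)

theorem yields_innerLoop (hNL : n * L ≤ N) {A : Learner} {t t' : ℕ} {K : List Cmd}
    {rest : List (ℕ × ℕ)} (hrest : ∀ p ∈ rest, p.1 < p.2 ∧ p.2 < n) {j : ℕ}
    (hK : ∀ s', Ready n L s' → s'.i = j → s'.j = j →
      A.Runs t (natRounds hNL G rest hrest) s'.learner →
      Yields verdict t' (K, s'.mem G) (outcome A t n s' (natRounds hNL G rest hrest)))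
    (d : ℕ) (s : State) (hs : Ready n L s) (hi : s.i + d = j) (hj : s.j = j)
    (h : ∀ p ∈ (List.range' s.i d).map (fun i => (i, j)) ++ rest, p.1 < p.2 ∧ p.2 < n)
    (hruns : A.Runs t (natRounds hNL G _ h) s.learner) :
    Yields verdict (d * (2 * t + overhead L + 1) + 1 + t')
      (.loop (.sub (var 5) (var 6)) (roundCmd A) :: K, s.mem G)
      (outcome A t n s (natRounds hNL G _ h)) := by
  induction d generalizing s with
  | zero =>
    have htest : (Expr.sub (var 5) (var 6)).eval (s.mem G) = 0 := by
      simp only [Expr.eval, eval_var, State.vars]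
      omega
    exact ((reach_loop_false htest _ _).yields (hK s hs (by omega) hj hruns)).mono (by omega)
  | succ d ih =>
    have htest : (Expr.sub (var 5) (var 6)).eval (s.mem G) ≠ 0 := by
      simp only [Expr.eval, eval_var, State.vars]
      omega
    subst hj
    have hij : s.i < s.j ∧ s.j < n := h (s.i, s.j) (by simp [List.range'_succ])
    have hround := yields_roundCmd (G := G) hNL (A := A) (t := t) hs hij
      (rs := natRounds hNL G ((List.range' (s.i + 1) d).map (fun i => (i, s.j)) ++ rest)
        fun p hp => h p (List.mem_cons_of_mem _ hp))
      (K := .loop (.sub (var 5) (var 6)) (roundCmd A) :: K)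
      (t' := d * (2 * t + overhead L + 1) + 1 + t') hruns
      (by
        intro s' hs' hi' hj' hruns'
        have h' : ∀ p ∈ (List.range' s'.i d).map (fun i => (i, s.j)) ++ rest,
            p.1 < p.2 ∧ p.2 < n := by
          rw [hi']
          exact fun p hp => h p (List.mem_cons_of_mem _ hp)
        have := ih s' hs' (by omega) hj' h'
        simp only [hi'] at this
        exact this hruns')
    refine ((reach_loop_true htest _ _).yields hround).mono ?_
    ring_nf
    omega

/-- Plays all rounds with the learner `A`. -/
def playCmd (A : Learner) : Cmd := .loop (.sub (var 2) (var 5))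
  (seqs [.loop (.sub (var 5) (var 6)) (roundCmd A), put 6 (.const 0),
    put 5 (.add (var 5) (.const 1))])

theorem yields_playCmd (hNL : n * L ≤ N) {A : Learner} {t t' : ℕ} {K : List Cmd}
    (hK : ∀ s', Ready n L s' →
      Yields verdict t' (K, s'.mem G) (outcome A t n s' ([] : List (Round n L))))
    (d : ℕ) (s : State) (hs : Ready n L s) (hi : s.i = 0) (hj : s.j + d = n)
    (h : ∀ p ∈ (List.range' s.j d).flatMap (fun j => (List.range j).map fun i => (i, j)),
      p.1 < p.2 ∧ p.2 < n)
    (hruns : A.Runs t (natRounds hNL G _ h) s.learner) :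
    Yields verdict (d * (n * (2 * t + overhead L + 1) + 10) + 1 + t') (playCmd A :: K, s.mem G)
      (outcome A t n s (natRounds hNL G _ h)) := by
  induction d generalizing s with
  | zero =>
    have htest : (Expr.sub (var 2) (var 5)).eval (s.mem G) = 0 := by
      simp only [Expr.eval, eval_var, State.vars, hs.num]
      omega
    exact ((reach_loop_false htest _ _).yields (hK s hs)).mono (by omega)
  | succ d ih =>
    have htest : (Expr.sub (var 2) (var 5)).eval (s.mem G) ≠ 0 := by
      simp only [Expr.eval, eval_var, State.vars, hs.num]
      omega
    have hlist : (List.range' s.j (d + 1)).flatMap (fun j => (List.range j).map fun i => (i, j)) =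
        (List.range' s.i s.j).map (fun i => (i, s.j)) ++
          (List.range' (s.j + 1) d).flatMap (fun j => (List.range j).map fun i => (i, j)) := by
      rw [List.range'_succ, List.flatMap_cons, hi, List.range_eq_range']
    -- `natRounds` depends on a proof about its list, so the list is generalized before its
    -- decomposition is substituted.
    have hgen : ∀ ps (hps : ∀ p ∈ ps, p.1 < p.2 ∧ p.2 < n),
        ps = (List.range' s.i s.j).map (fun i => (i, s.j)) ++
          (List.range' (s.j + 1) d).flatMap (fun j => (List.range j).map fun i => (i, j)) →
        A.Runs t (natRounds hNL G ps hps) s.learner →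
        Yields verdict ((d + 1) * (n * (2 * t + overhead L + 1) + 10) + 1 + t')
          (playCmd A :: K, s.mem G) (outcome A t n s (natRounds hNL G ps hps)) := by
      rintro ps hps rfl hruns
      have hinner := yields_innerLoop (G := G) hNL (A := A) (t := t) (j := s.j)
        (rest := (List.range' (s.j + 1) d).flatMap fun j => (List.range j).map fun i => (i, j))
        (K := seqs [put 6 (.const 0), put 5 (.add (var 5) (.const 1))] :: playCmd A :: K)
        (t' := 5 + (d * (n * (2 * t + overhead L + 1) + 10) + 1 + t'))
        (fun p hp => hps p (List.mem_append_right _ hp))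
        (by
          intro s' hs' hi' hj' hruns'
          have h1 : Reach 5 (seqs [put 6 (.const 0), put 5 (.add (var 5) (.const 1))] ::
              playCmd A :: K, s'.mem G)
              (playCmd A :: K, State.mem G { s' with i := 0, j := s.j + 1 }) := by
            refine Reach.to (Reach.seqs_cons (reach_put_i G _ _ _) (Reach.seqs_cons
              (reach_put_j G _ _ _) (reach_seqs_nil _ _))) ?_ le_rfl
            simp [Expr.eval, eval_var, State.vars, hj']
          exact h1.yields (ih { s' with i := 0, j := s.j + 1 }
            ⟨hs'.num, hs'.labels, hs'.base, hs'.a, hs'.b⟩ rfl (by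
              change s.j + 1 + d = n
              omega) _ hruns'))
        s.j s hs (by omega) rfl hps hruns
      refine ((reach_loop_true htest _ _).yields (Yields.seqs_cons hinner)).mono ?_
      have : s.j * (2 * t + overhead L + 1) ≤ n * (2 * t + overhead L + 1) :=
        Nat.mul_le_mul_right _ (by omega)
      rw [Nat.add_mul, Nat.one_mul]
      omega
    exact hgen _ h hlist hruns

/-- Compares the score with the threshold. -/
def decideCmd : Cmd :=
  put 0 (.sub (.add (var 7) (.const 1)) (.add (var 8) (.add (var 2) (var 2))))

/-- Runs the learner on the graph. -/
def mainCmd (A : Learner) : Cmd := seqs [countCmd, startCmd, playCmd A, decideCmd]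

/-- The distinguisher that is built from a learner. -/
def distinguisher (A : Learner) (a b : ℕ) : Cmd :=
  seqs [itemsCmd a b, gridCmd, .ite (var 3) (mainCmd A) .skip]

/-- In truncated subtraction, `pos + 1 - (neg + 2 * n)` is nonzero exactly when `pos - neg` is at
least `2 * n`; the `+ 1` makes the comparison non-strict. -/
theorem yields_decideCmd (A : Learner) (t : ℕ) {s : State} (hs : Ready n L s) :
    Yields verdict 4 ([seqs [decideCmd], seqs []], s.mem G)
      (outcome A t n s ([] : List (Round n L))) := by
  have h := (Reach.seqs_cons (reach_put_out G s (.sub (.add (var 7) (.const 1))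
    (.add (var 8) (.add (var 2) (var 2)))) _) ((reach_seqs_nil [seqs []] _).trans
      (reach_seqs_nil [] _))).yields (Yields.nil verdict 0 _)
  have ho : outcome A t n s ([] : List (Round n L)) =
      PMF.pure (verdict (State.mem G { s with out := (Expr.sub (.add (var 7) (.const 1))
        (.add (var 8) (.add (var 2) (var 2)))).eval (s.mem G) })) := by
    simp only [outcome, Learner.play, PMF.pure_map]
    congr 1
    simp only [verdict, Expr.eval, eval_var, State.vars, State.mem, hs.num, if_true]
    refine decide_eq_decide.2 ?_
    rw [add_zero, le_sub_iff_add_le, ne_eq, Nat.sub_eq_zero_iff_le, not_le, Nat.lt_succ_iff]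
    rw [← Nat.cast_le (α := ℚ)]
    push_cast
    constructor <;> intro <;> linarith
  rw [ho]
  exact h

theorem yields_mainCmd {A : Learner} {t : ℕ} (hNL : n * L ≤ N) (P : ℕ)
    (hruns : A.Runs t (graphRounds (vertex hNL) G (allPairs n))
      (startMem n L (allPairs n).length)) :
    Yields verdict (n * (n * (2 * t + overhead L + 1) + 10) + 6 * n + 30)
      ([mainCmd A, seqs []], (gridState P n L).mem G)
      ((A.play t (graphRounds (vertex hNL) G (allPairs n))
        (startMem n L (allPairs n).length)).map fun x => decide ((2 * n : ℚ) ≤ x)) := by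
  set s₁ : State := { gridState P n L with rounds := ∑ j ∈ Finset.range n, j } with hs₁
  set s₂ : State := { s₁ with learner := startMem n L (allPairs n).length } with hs₂
  have hready : Ready n L s₂ :=
    ⟨rfl, rfl, fun x hx => by simp [hs₂, hs₁, gridState, hx.le], rfl, rfl⟩
  have hlist : (List.range' s₂.j n).flatMap (fun j => (List.range j).map fun i => (i, j)) =
      natPairs n := by
    change (List.range' 0 n).flatMap _ = _
    rw [natPairs, List.range_eq_range' (n := n)]
  have hgen : ∀ ps (hps : ∀ p ∈ ps, p.1 < p.2 ∧ p.2 < n), ps = natPairs n →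
      A.Runs t (natRounds hNL G ps hps) s₂.learner ∧
      outcome A t n s₂ (natRounds hNL G ps hps) =
        (A.play t (graphRounds (vertex hNL) G (allPairs n))
        (startMem n L (allPairs n).length)).map fun x => decide ((2 * n : ℚ) ≤ x) := by
    rintro ps hps rfl
    refine ⟨hruns, ?_⟩
    rw [outcome]
    congr 1
    funext x
    simp [hs₂, hs₁, gridState]
  have hps : ∀ p ∈ (List.range' s₂.j n).flatMap (fun j => (List.range j).map fun i => (i, j)),
      p.1 < p.2 ∧ p.2 < n := by
    rw [hlist]
    exact fun p => mem_natPairs.1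
  obtain ⟨hr, ho⟩ := hgen _ hps hlist
  rw [← ho]
  have hplay := yields_playCmd hNL (K := [seqs [decideCmd], seqs []]) (t' := 4)
    (fun s' hs' => yields_decideCmd A t hs') n s₂ hready rfl (Nat.zero_add n) hps hr
  have hcount := reach_countCmd G (s := gridState P n L) rfl rfl
    (seqs [startCmd, playCmd A, decideCmd] :: [seqs []])
  have hstart := reach_startCmd G (s := s₁) rfl (seqs [playCmd A, decideCmd] :: [seqs []])
  have e : State.mem G { s₁ with learner := startMem s₁.num s₁.labels s₁.rounds } =
      s₂.mem G := by
    rw [hs₂, length_allPairs]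
    rfl
  rw [e] at hstart
  refine (((Reach.seqs_cons hcount (Reach.seqs_cons hstart
    (reach_seqs_cons _ _ _ _))).yields hplay)).mono ?_
  change 6 * n + 5 + (7 + 1 + 1) + 1 + _ ≤ _
  omega

/-- The number of steps of the distinguisher, if each activation of the learner takes `t` steps. -/
def runningTime (N t : ℕ) : ℕ := N * (N * (2 * t + overhead N + 1) + 10) + 40 * N + 100

theorem reach_distinguisher (A : Learner) {a b : ℕ} (hb : 0 < b) :
    Reach (16 * N + 24) ([distinguisher A a b], graphMem G)
      ([.ite (var 3) (mainCmd A) .skip, seqs []],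
        (gridState ((2 ^ b) ^ Nat.clog (2 ^ b) (N + 1)) (items a b N)
          (N / items a b N)).mem G) := by
  rw [← mem_default]
  exact (Reach.seqs_cons (reach_itemsCmd G hb _) (Reach.seqs_cons
    (reach_gridCmd G (items_pos a b N) _) (reach_seqs_cons _ _ _ _))).mono (by omega)

theorem yields_distinguisher {A : Learner} {a b : ℕ} (hb : 0 < b) {t : ℕ}
    (hNL : items a b N * (N / items a b N) ≤ N) (hL : 1 ≤ N / items a b N)
    (hruns : A.Runs t (graphRounds (vertex hNL) G (allPairs (items a b N)))
      (startMem (items a b N) (N / items a b N) (allPairs (items a b N)).length)) :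
    Yields verdict (runningTime N t) ([distinguisher A a b], graphMem G)
      ((A.play t (graphRounds (vertex hNL) G (allPairs (items a b N)))
        (startMem (items a b N) (N / items a b N) (allPairs (items a b N)).length)).map
          fun x => decide ((2 * items a b N : ℚ) ≤ x)) := by
  have hnN : items a b N ≤ N := by
    by_contra hc
    have := Nat.div_eq_of_lt (not_le.1 hc)
    omega
  have hLN : N / items a b N ≤ N := Nat.div_le_self _ _
  have hov : overhead (N / items a b N) ≤ overhead N := by
    unfold overhead
    gcongr
  have htest : (var 3).eval ((gridState ((2 ^ b) ^ Nat.clog (2 ^ b) (N + 1)) (items a b N)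
      (N / items a b N)).mem G) ≠ 0 := by
    simp only [eval_var, State.vars, gridState]
    omega
  refine (((reach_distinguisher A hb).trans (reach_ite_true htest _ _ _)).yields
    (yields_mainCmd hNL _ hruns)).mono ?_
  have : items a b N * (items a b N * (2 * t + overhead (N / items a b N) + 1) + 10) ≤
      N * (N * (2 * t + overhead N + 1) + 10) := by gcongr
  unfold runningTime
  omega

/-- Without labels the learner comes with no guarantee and is not started; the distinguisher must
nevertheless halt on every graph. -/
theorem yields_distinguisher_of_labels_eq_zero (A : Learner) {a b : ℕ} (hb : 0 < b) (t : ℕ)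
    (hL : N / items a b N = 0) :
    Yields verdict (runningTime N t) ([distinguisher A a b], graphMem G) (PMF.pure false) := by
  have htest : (var 3).eval ((gridState ((2 ^ b) ^ Nat.clog (2 ^ b) (N + 1)) (items a b N)
      (N / items a b N)).mem G) = 0 := by
    simp only [eval_var, State.vars, gridState, hL]
  have h := (((reach_distinguisher A hb).trans (reach_ite_false htest _ _ _)).trans
    ((reach_skip _ _).trans (reach_seqs_nil _ _))).yields (Yields.nil verdict 0 _)
  refine Yields.mono h ?_
  unfold runningTime
  omega

end PlantedClique

/-! ### Polynomial bounds and instance sizes -/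

theorem Polynomial.eval_mono_nat (p : Polynomial ℕ) {x y : ℕ} (h : x ≤ y) : p.eval x ≤ p.eval y := by
  rw [Polynomial.eval_eq_sum_range, Polynomial.eval_eq_sum_range]
  exact Finset.sum_le_sum fun i _ => Nat.mul_le_mul_left _ (Nat.pow_le_pow_left h i)

namespace OnlineLocal

open RAM

variable {n L : ℕ}

theorem bits_signRound (p : ItemPair n) (w : Fin L → Fin L → Bool) :
    (signRound p w).bits = 3 * (L * L) := by
  have : ∀ a b, 1 + Nat.size ((signRound p w).payoff a b).num.natAbs +
      Nat.size ((signRound p w).payoff a b).den = 3 := by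
    intro a b
    simp only [signRound]
    cases w a b <;> simp
  simp only [Round.bits, this, Finset.sum_const, Finset.card_univ, Fintype.card_fin, smul_eq_mul]
  ring

/-- The size of an instance that consists of `T` sign rounds. -/
def signSize (n L T : ℕ) : ℕ := n + L + T + T * (3 * (L * L))

theorem IsSign.length_eq {rs : List (Round n L)} {ps : List (ItemPair n)} (h : IsSign rs ps) :
    rs.length = ps.length := List.Forall₂.length_eq h

/-- The size ignores the signs, so a single time budget per activation serves all the instances over
which `roundMean` averages. -/
theorem IsSign.size_eq {rs : List (Round n L)} {ps : List (ItemPair n)} (h : IsSign rs ps) :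
    size n L rs = signSize n L ps.length := by
  have : (rs.map Round.bits).sum = ps.length * (3 * (L * L)) := by
    induction h with
    | nil => simp
    | cons hr _ ih =>
      obtain ⟨w, rfl⟩ := hr
      simp [ih, bits_signRound]
      ring
  rw [size, signSize, h.length_eq, this]

/-! ### Fewer than constant regret in a single round -/

theorem ev_play_singleton (A : Learner) (t : ℕ) (r : Round n L) (σ : Mem) :
    (A.play t [r] σ).ev (fun x => (x : ℝ)) =
      (exec t A.predict (r.ask σ)).ev fun τ => (r.reward (label₁ τ) (label₂ τ) : ℝ) := by
  rw [ev_play A t (H := fun _ _ => false), ev_trace_cons]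
  simp [Learner.trace, PMF.ev_pure, PMF.ev_const]

/-- The round for two items whose payoff is `±1` according to whether the first label is zero. -/
def testRound (L : ℕ) (s : Bool) : Round 2 L :=
  signRound ⟨(0, 1), by simp⟩ fun a _ => xor s (decide ((a : ℕ) = 0))

theorem reward_testRound (a b : ℕ) :
    (testRound L true).reward a b = -(testRound L false).reward a b := by
  by_cases h : a < L ∧ b < L
  · by_cases h0 : a = 0
    · subst h0
      simp [testRound, Round.reward, signRound, h]
    · simp [testRound, Round.reward, signRound, h, h0]
  · simp [Round.reward, h]

theorem one_le_opt_testRound (hL : 2 ≤ L) (s : Bool) : 1 ≤ opt [testRound L s] := by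
  have h0 : 0 < L := by omega
  cases s
  · refine le_trans ?_ (le_opt _ fun _ => ⟨0, h0⟩)
    simp [testRound, signRound]
  · refine le_trans ?_ (le_opt _ fun _ => ⟨1, hL⟩)
    simp [testRound, signRound]

/-- For two items, one round and many labels the bound falls below 1. Two opposite payoffs, each
with optimum at least 1, would both have to earn a positive expectation, yet the prediction is the
same for both and the expectations sum to zero. -/
theorem not_regretInPolyTime {ε : ℝ} (hε : 1 < ε) :
    ¬RegretInPolyTime fun n L T => Real.sqrt ((n : ℝ) * (L : ℝ) ^ (1 - ε) * (T : ℝ)) := by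
  rintro ⟨A, p, C, h⟩
  set D := max C 1
  have hD : 0 < D := lt_max_of_lt_right one_pos
  have hlim : Tendsto (fun L : ℕ => (L : ℝ) ^ (1 - ε)) atTop (nhds 0) := by
    have := (tendsto_rpow_neg_atTop (sub_pos.2 hε)).comp tendsto_natCast_atTop_atTop
    simpa [Function.comp_def] using this
  obtain ⟨L, hL1, hL2⟩ := ((hlim.eventually_lt_const
    (show 0 < 1 / (4 * D ^ 2) by positivity)).and (eventually_ge_atTop 2)).exists
  have hsize : ∀ s, size 2 L [testRound L s] = signSize 2 L 1 := fun s =>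
    IsSign.size_eq (ps := [⟨(0, 1), by simp⟩]) (.cons ⟨_, rfl⟩ .nil)
  have hsqrt : D * Real.sqrt (((2 : ℕ) : ℝ) * (L : ℝ) ^ (1 - ε) * ((1 : ℕ) : ℝ)) < 1 := by
    have h1 : Real.sqrt (((2 : ℕ) : ℝ) * (L : ℝ) ^ (1 - ε) * ((1 : ℕ) : ℝ)) < 1 / D := by
      rw [Real.sqrt_lt' (by positivity)]
      rw [lt_div_iff₀ (by positivity)] at hL1
      rw [one_div, inv_pow, ← one_div, lt_div_iff₀ (by positivity)]
      push_cast
      linarith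
    calc _ < D * (1 / D) := by gcongr
      _ = 1 := by field_simp
  have key : ∀ s, 1 - D * Real.sqrt (((2 : ℕ) : ℝ) * (L : ℝ) ^ (1 - ε) * ((1 : ℕ) : ℝ)) ≤
      (exec (p.eval (signSize 2 L 1)) A.predict
        ((testRound L false).ask (startMem 2 L 1))).ev
        fun τ => ((testRound L s).reward (label₁ τ) (label₂ τ) : ℝ) := by
    intro s
    have h1 := (h 2 L [testRound L s] (by omega)).2
    rw [hsize] at h1
    have h2 := one_le_opt_testRound hL2 s
    have h3 : A.expectedPayoff (p.eval (signSize 2 L 1)) [testRound L s] = _ :=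
      ev_play_singleton A _ (testRound L s) (startMem 2 L 1)
    rw [h3] at h1
    have h4 : C * Real.sqrt (((2 : ℕ) : ℝ) * (L : ℝ) ^ (1 - ε) * (([testRound L s].length : ℕ) : ℝ))
        ≤ D * Real.sqrt (((2 : ℕ) : ℝ) * (L : ℝ) ^ (1 - ε) * ((1 : ℕ) : ℝ)) :=
      mul_le_mul_of_nonneg_right (le_max_left _ _) (Real.sqrt_nonneg _)
    have h5 := h1.trans h4
    -- The two rounds ask for the same items, so the learner cannot tell them apart.
    have h6 : (testRound L false).ask (startMem 2 L 1) = (testRound L s).ask (startMem 2 L 1) := rfl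
    rw [h6]
    linarith
  have k1 := key true
  have k2 := key false
  have : ∀ τ : Mem, ((testRound L true).reward (label₁ τ) (label₂ τ) : ℝ) =
      (-1) * ((testRound L false).reward (label₁ τ) (label₂ τ) : ℝ) := by
    intro τ
    rw [reward_testRound]
    push_cast
    ring
  simp only [this, PMF.ev_const_mul] at k1
  linarith

end OnlineLocal

/-! ### Correctness and running time of the distinguisher -/

namespace PlantedClique

open RAM OnlineLocal

theorem Yields.halts_and_answer_eq {N t : ℕ} {G : SimpleGraph (Fin N)} {D : Cmd} {ν : PMF Bool}
    (h : Yields verdict t ([D], graphMem G) ν) :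
    HaltsWithin t D (graphMem G) ∧ answer D t G = ν := by
  refine ⟨h.1, ?_⟩
  rw [← h.2, answer, exec, PMF.map_comp]
  rfl

theorem isSign_graphRounds {N n L : ℕ} (vert : Fin n → Fin L → Fin N) (G : SimpleGraph (Fin N))
    (ps : List (ItemPair n)) : IsSign (graphRounds vert G ps) ps := by
  induction ps with
  | nil => exact .nil
  | cons p ps ih => exact .cons ⟨_, rfl⟩ ih

theorem four_fifths_le_ofReal {r : ℝ} (h : 4 / 5 ≤ r) : (4 / 5 : ℝ≥0∞) ≤ ENNReal.ofReal r := by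
  have : (4 / 5 : ℝ≥0∞) = ENNReal.ofReal (4 / 5) := by
    rw [ENNReal.ofReal_div_of_pos (by norm_num)]
    simp
  rw [this]
  exact ENNReal.ofReal_le_ofReal h

/-- Some labeling hits the planted set wherever this is possible. -/
theorem exists_labeling {n L : ℕ} (hL : 1 ≤ L) (H : Fin n → Fin L → Bool) :
    ∃ l : Fin n → Fin L, ∀ i a, H i a = true → H i (l i) = true := by
  have : ∀ i, ∃ b, ∀ a, H i a = true → H i b = true := by
    intro i
    by_cases h : ∃ b, H i b = true
    · exact ⟨h.choose, fun _ _ => h.choose_spec⟩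
    · exact ⟨⟨0, hL⟩, fun a ha => absurd ⟨a, ha⟩ h⟩
  choose l hl using this
  exact ⟨l, hl⟩

/-- The error is at most `1/8` on the random graph. On the planted one it is at most `1/20 + 1/32 <
1/10` for a set meeting at least `k / 2` items, and other sets have probability at most `1/20`. -/
theorem distinguishable_of_regret {ε : ℝ} (h0 : 0 < ε) (h1 : ε ≤ 1)
    (h : RegretInPolyTime fun n L T => Real.sqrt ((n : ℝ) * (L : ℝ) ^ (1 - ε) * (T : ℝ))) :
    DistinguishableInPolyTime (cliqueSize (ε / 6)) := by
  obtain ⟨A, p, C, hA⟩ := h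
  obtain ⟨a, b, hb, hpar⟩ := exists_parameters h0 h1
  -- `q` bounds the instance size in terms of `N`, using `n, L ≤ N` and `T ≤ N²`; `Q` is the
  -- resulting total running time.
  set q : Polynomial ℕ := .X + .X + .X ^ 2 + .X ^ 2 * (3 * (.X * .X)) with hq
  set Q : Polynomial ℕ := .X * (.X * (2 * p.comp q + (10 * .X * .X + 8 * .X + 20) + 1) + 10) +
    40 * .X + 100 with hQ
  have hQeval : ∀ N, Q.eval N = runningTime N (p.eval (q.eval N)) := by
    intro N
    simp [hQ, runningTime, overhead]
  have htime : ∀ N t, t ≤ p.eval (q.eval N) → runningTime N t ≤ Q.eval N := by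
    intro N t ht
    rw [hQeval]
    unfold runningTime
    gcongr
  set n : ℕ → ℕ := items a b with hn
  set T : ℕ → ℕ := fun N => (allPairs (n N)).length with hT
  set tm : ℕ → ℕ := fun N => p.eval (signSize (n N) (N / n N) (T N)) with htm
  have htm_le : ∀ N, 1 ≤ N / n N → tm N ≤ p.eval (q.eval N) := by
    intro N hL
    have hnN : n N ≤ N := by
      by_contra hc
      have := Nat.div_eq_of_lt (not_le.1 hc)
      omega
    have hLN : N / n N ≤ N := Nat.div_le_self _ _
    have hTN : T N ≤ N ^ 2 := by
      have := two_mul_length_allPairs_le (n N)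
      have : n N * n N ≤ N * N := Nat.mul_le_mul hnN hnN
      rw [sq]
      simp only [hT]
      omega
    refine p.eval_mono_nat ?_
    have : q.eval N = N + N + N ^ 2 + N ^ 2 * (3 * (N * N)) := by simp [hq]
    rw [this, signSize]
    gcongr
  have hNL : ∀ N, n N * (N / n N) ≤ N := fun N => Nat.mul_div_le N (n N)
  have hruns : ∀ N, 1 ≤ N / n N → ∀ rs : List (Round (n N) (N / n N)),
      IsSign rs (allPairs (n N)) → A.Runs (tm N) rs (startMem (n N) (N / n N) (T N)) ∧
      opt rs - (A.play (tm N) rs (startMem (n N) (N / n N) (T N))).ev (fun x => (x : ℝ)) ≤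
        C * Real.sqrt ((n N : ℝ) * ((N / n N : ℕ) : ℝ) ^ (1 - ε) * (T N : ℝ)) := by
    intro N hL rs hrs
    have := hA (n N) (N / n N) rs hL
    rw [hrs.size_eq, hrs.length_eq] at this
    refine ⟨this.1, ?_⟩
    have h2 := this.2
    rw [Learner.expectedPayoff, hrs.length_eq] at h2
    exact h2
  have hanswer : ∀ N, 1 ≤ N / n N → ∀ G : SimpleGraph (Fin N),
      HaltsWithin (Q.eval N) (distinguisher A a b) (graphMem G) ∧
      answer (distinguisher A a b) (Q.eval N) G =
        (A.play (tm N) (graphRounds (vertex (hNL N)) G (allPairs (n N)))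
          (startMem (n N) (N / n N) (T N))).map fun x => decide ((2 * n N : ℚ) ≤ x) := by
    intro N hL G
    exact Yields.halts_and_answer_eq ((yields_distinguisher hb (hNL N) hL
      (hruns N hL _ (isSign_graphRounds _ _ _)).1).mono (htime N _ (htm_le N hL)))
  refine ⟨distinguisher A a b, Q, ?_, ?_⟩
  · intro N G
    rcases Nat.eq_zero_or_pos (N / n N) with hL | hL
    · exact (Yields.halts_and_answer_eq ((yields_distinguisher_of_labels_eq_zero A hb 0 hL).mono
        (htime N 0 (Nat.zero_le _)))).1
    · exact (hanswer N hL G).1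
  · have hD : 0 < max C 1 := lt_max_of_lt_right one_pos
    filter_upwards [hpar _ hD, eventually_gt_atTop 0] with N hN hN0
    obtain ⟨hN1, hN2, hN3⟩ := hN
    have hn0 : 0 < n N := items_pos a b N
    have hL : 1 ≤ N / n N := by
      rw [Nat.le_div_iff_mul_le hn0]
      omega
    set σ := startMem (n N) (N / n N) (T N) with hσ
    set ps := allPairs (n N) with hps
    have hθ : (0 : ℝ) < 2 * n N := by positivity
    have hTn : (T N : ℝ) ≤ n N ^ 2 / 2 := by
      have := two_mul_length_allPairs_le (n N)
      have : (2 * T N : ℝ) ≤ n N * n N := by exact_mod_cast this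
      rw [sq]
      linarith
    have hprob : ∀ (G : SimpleGraph (Fin N)) (v : Bool),
        (answer (distinguisher A a b) (Q.eval N) G v).toReal =
          (A.play (tm N) (graphRounds (vertex (hNL N)) G ps) σ).ev
            fun x => if decide ((2 * n N : ℝ) ≤ x) = v then 1 else 0 := by
      intro G v
      rw [(hanswer N hL G).2, PMF.toReal_apply_eq_ev,
        PMF.ev_map (finite_support_play A (tm N) _ _)]
      congr 1
      funext x
      have : ((2 * n N : ℚ) ≤ x) ↔ ((2 * n N : ℝ) ≤ x) := by
        rw [← Rat.cast_le (K := ℝ)]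
        push_cast
        rfl
      simp only [this]
    -- Success is expressed as one minus the error, the form in which the tail bounds apply. The
    -- random graph is the case of empty `S`.
    have hmean : ∀ (S : Finset (Fin N)) (v : Bool),
        (graphMean fun G => (answer (distinguisher A a b) (Q.eval N) (G ⊔ cliqueOn S) v).toReal) =
          1 - roundMean (fun i c => decide (vertex (hNL N) i c ∈ S)) ps fun rs =>
            (A.play (tm N) rs σ).ev
              fun x => if decide ((2 * n N : ℝ) ≤ x) = v then 0 else 1 := by
      intro S v
      simp only [hprob]
      rw [graphMean_graphRounds (vertex_injective (hNL N)) S (pairwise_allPairs (n N))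
        fun rs => (A.play (tm N) rs σ).ev fun x => if decide ((2 * n N : ℝ) ≤ x) = v then 1 else 0]
      rw [eq_sub_iff_add_eq, ← roundMean_add]
      conv_rhs => rw [← roundMean_const
        (H := fun i c => decide (vertex (hNL N) i c ∈ S)) ps 1]
      congr 1
      funext rs
      rw [← PMF.ev_add (finite_support_play A (tm N) rs σ),
        ← PMF.ev_const (A.play (tm N) rs σ) 1]
      congr 1
      funext x
      split_ifs <;> simp [PMF.ev_const]
    constructor
    · rw [lintegral_randomGraph fun G => PMF.apply_ne_top _ _]
      refine four_fifths_le_ofReal ?_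
      have hm := hmean ∅ false
      simp only [cliqueOn_empty, sup_bot_eq, Finset.notMem_empty, decide_false] at hm
      rw [hm]
      have hr := roundMean_random_le (L := N / n N) A (tm N) ps σ hθ
      have hle : (ps.length : ℝ) / (2 * n N) ^ 2 ≤ 1 / 8 := by
        rw [div_le_iff₀ (by positivity)]
        have : (ps.length : ℝ) = T N := rfl
        rw [this]
        nlinarith
      have he : ∀ x : ℚ, (if decide ((2 * n N : ℝ) ≤ x) = false then (0 : ℝ) else 1) =
          if (2 * n N : ℝ) ≤ x then 1 else 0 := by
        intro x
        by_cases hx : (2 * n N : ℝ) ≤ x <;> simp [hx]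
      simp only [he]
      linarith
    · rw [lintegral_plantedGraph fun G => PMF.apply_ne_top _ _]
      set k := cliqueSize (ε / 6) N with hk
      have hfew := card_few_hits_le (hNL N) hn0
        (by have := Nat.lt_mul_div_succ N hn0; rw [Nat.mul_add, Nat.mul_one] at this; omega)
        hN1 hN2
      set P := Finset.powersetCard k (Finset.univ : Finset (Fin N)) with hP
      have hgood : ∀ S ∈ P, ¬2 * (hitItems (hNL N) S).card < k →
          9 / 10 ≤ graphMean fun G =>
            (answer (distinguisher A a b) (Q.eval N) (G ⊔ cliqueOn S) true).toReal := by
        intro S hS hSk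
        rw [hmean]
        obtain ⟨l, hl⟩ := exists_labeling hL fun i c => decide (vertex (hNL N) i c ∈ S)
        have hM := hN3 _ _ (not_lt.1 hSk) (card_sq_le_hitPairs
          (H := fun i c => decide (vertex (hNL N) i c ∈ S)) (l := l) (hitItems (hNL N) S) (by
            intro i hi
            simp only [hitItems, Finset.mem_filter, Finset.mem_univ, true_and] at hi
            obtain ⟨c, hc⟩ := hi
            exact hl i c (decide_eq_true hc)))
        have hR : 0 < max C 1 * Real.sqrt ((n N : ℝ) ^ 3 * ((N / n N : ℕ) : ℝ) ^ (1 - ε)) := by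
          have : (0 : ℝ) < ((N / n N : ℕ) : ℝ) := Nat.cast_pos.2 hL
          positivity
        have hr := roundMean_planted_le A (tm N) hl ps σ hR hθ (fun rs hrs => by
          refine (hruns N hL rs hrs).2.trans ?_
          refine (mul_le_mul_of_nonneg_right (le_max_left C 1) (Real.sqrt_nonneg _)).trans ?_
          refine mul_le_mul_of_nonneg_left (Real.sqrt_le_sqrt ?_) hD.le
          have : (n N : ℝ) ^ 3 * ((N / n N : ℕ) : ℝ) ^ (1 - ε) =
              (n N : ℝ) * ((N / n N : ℕ) : ℝ) ^ (1 - ε) * (n N : ℝ) ^ 2 := by ring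
          rw [this]
          gcongr
          nlinarith) hM
        have hle : (ps.length : ℝ) / (4 * (2 * n N) ^ 2) ≤ 1 / 32 := by
          rw [div_le_iff₀ (by positivity)]
          have : (ps.length : ℝ) = T N := rfl
          rw [this]
          nlinarith
        have he : ∀ x : ℚ, (if decide ((2 * n N : ℝ) ≤ x) = true then (0 : ℝ) else 1) =
            if (x : ℝ) < 2 * n N then 1 else 0 := by
          intro x
          by_cases hx : (2 * n N : ℝ) ≤ x
          · simp [hx, not_lt.2 hx]
          · simp [hx, not_le.1 hx]
        simp only [he]
        linarith
      have hkN : k ≤ N := by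
        omega
      have hch : (0 : ℝ) < N.choose k := Nat.cast_pos.2 (Nat.choose_pos hkN)
      have hsum : 4 / 5 * (N.choose k : ℝ) ≤ ∑ S ∈ P, graphMean fun G =>
          (answer (distinguisher A a b) (Q.eval N) (G ⊔ cliqueOn S) true).toReal := by
        have hcard : (P.card : ℝ) = N.choose k := by
          rw [hP, Finset.card_powersetCard, Finset.card_univ, Fintype.card_fin]
        have hfew' : 20 * ((P.filter fun S => 2 * (hitItems (hNL N) S).card < k).card : ℝ) ≤
            N.choose k := by exact_mod_cast hfew
        have hpos : ∀ S : Finset (Fin N), 0 ≤ graphMean fun G =>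
            (answer (distinguisher A a b) (Q.eval N) (G ⊔ cliqueOn S) true).toReal := by
          intro S
          unfold graphMean
          exact mul_nonneg (by positivity) (Finset.sum_nonneg fun _ _ => ENNReal.toReal_nonneg)
        calc 4 / 5 * (N.choose k : ℝ) ≤ 9 / 10 * P.card -
              9 / 10 * (P.filter fun S => 2 * (hitItems (hNL N) S).card < k).card := by
              rw [hcard]
              linarith
          _ = ∑ S ∈ P, (9 / 10 -
              if 2 * (hitItems (hNL N) S).card < k then (9 / 10 : ℝ) else 0) := by
              rw [Finset.sum_sub_distrib, ← Finset.sum_filter]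
              simp [mul_comm]
          _ ≤ _ := by
              refine Finset.sum_le_sum fun S hS => ?_
              split_ifs with hc
              · simpa using hpos S
              · simpa using hgood S hS hc
      rw [← ENNReal.ofReal_sum_of_nonneg, ← ENNReal.ofReal_natCast,
        ← ENNReal.ofReal_inv_of_pos hch, ← ENNReal.ofReal_mul (by positivity)]
      · refine four_fifths_le_ofReal ?_
        rw [inv_mul_eq_div, le_div_iff₀ hch]
        exact hsum
      · intro S _
        unfold graphMean
        exact mul_nonneg (by positivity) (Finset.sum_nonneg fun _ _ => ENNReal.toReal_nonneg)

end PlantedClique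

theorem corollary1 :
    (∀ ε : ℝ, 0 < ε →
      OnlineLocal.RegretInPolyTime
        (fun n L T => Real.sqrt ((n : ℝ) * (L : ℝ) ^ (1 - ε) * (T : ℝ))) →
      PlantedClique.DistinguishableInPolyTime (PlantedClique.cliqueSize (ε / 6))) ∧
    (PlantedClique.Conjecture →
      ∀ δ : ℝ, 0 < δ →
        ¬ OnlineLocal.RegretInPolyTime
          (fun n L T => Real.sqrt ((n : ℝ) * (L : ℝ) ^ (1 - δ) * (T : ℝ)))) := by
  have h : ∀ ε : ℝ, 0 < ε →
      OnlineLocal.RegretInPolyTime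
        (fun n L T => Real.sqrt ((n : ℝ) * (L : ℝ) ^ (1 - ε) * (T : ℝ))) →
      PlantedClique.DistinguishableInPolyTime (PlantedClique.cliqueSize (ε / 6)) := by
    intro ε h0 h
    -- The reduction needs `ε ≤ 1`; beyond that no learner satisfies the hypothesis.
    rcases le_or_gt ε 1 with h1 | h1
    · exact PlantedClique.distinguishable_of_regret h0 h1 h
    · exact absurd h (OnlineLocal.not_regretInPolyTime h1)
  exact ⟨h, fun hconj δ hδ hr => hconj (δ / 6) (by positivity) (h δ hδ hr)⟩
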